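/- Let $s,t\ge 1$ be coprime integers, $A=\{0,t,s+t\}$, and let $T_A\cong(\mathbb{C}^*)^2$ be the space of trinomials $f=z^{s+t}+pz^t+q$ with $p,q\in\mathbb{C}^*$, identified with the pairs $(p,q)$. For $1\le j\le s+t-1$ let $U_j^A\subseteq T_A$ be the set of those $f$ whose roots $a_1,\dots,a_{s+t}$ (listed with multiplicity and ordered so that $|a_1|\le\cdots\le|a_{s+t}|$) satisfy $|a_j|\ne|a_{j+1}|$, and let $(U_j^A)^c=T_A\setminus U_j^A$. Let $K(s+t,s)$ denote the torus knot, i.e. the embedded closed curve $S^1\to S^1\times S^1$, $u\mapsto(u^{s},u^{s+t})$, on the unit torus $S^1\times S^1=\{(p,q):|p|=|q|=1\}\subseteq T_A$. Then for every $j\in\{1,\dots,s+t-1\}\setminus\{t\}$ and for each of the two sets $X=U_j^A$ and $X=(U_j^A)^c$: there is an embedded closed curve $\rho$ on the unit torus which is a torus knot $K(s+t,s)$, namely ambient isotopic within the unit torus to $K(s+t,s)$, such that $X$ contains $\rho$ and $\rho$ is a strong deformation retract of $X$ (the identity of $X$ is homotopic, relative to $\rho$, to a retraction of $X$ onto $\rho$).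 Hence $X$ is connected and not simply connected, and $\pi_1(X,x)\cong\mathbb{Z}$ for every $x\in X$. -/

import Mathlib

open scoped unitInterval

namespace Trinomials

/-- The monic trinomial `z^(s+t) + p z^t + q`. -/
noncomputable def trinomial (s t : ℕ) (p q : ℂ) : Polynomial ℂ :=
  Polynomial.X ^ (s + t) + Polynomial.C p * Polynomial.X ^ t + Polynomial.C q

/-- The parameter space `T_A`, i.e. the pairs `(p, q)` of nonzero complex numbers, where `(p, q)`
stands for the trinomial `z^(s+t) + p z^t + q`. -/
def parameterSpace : Set (ℂ × ℂ) := {x | x.1 ≠ 0 ∧ x.2 ≠ 0}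

/-- The set `U_j^A` for `A = {0, t, s+t}`: those `(p, q)` in `T_A` such that, if the roots of the
trinomial, listed with multiplicity, are `a 1, …, a (s+t)` with `|a 1| ≤ ⋯ ≤ |a (s+t)|`, then
`|a j| ≠ |a (j+1)|`. Only the values `a i` with `1 ≤ i ≤ s+t` are constrained by the enumeration;
the definition is meant for `1 ≤ j ≤ s+t-1` (for `j = 0` and `j = s+t` it gives all of `T_A`,
which is the usual convention). -/
def rootNormGap (s t j : ℕ) : Set (ℂ × ℂ) :=
  {x | x ∈ parameterSpace ∧ ∃ a : ℕ → ℂ,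
    trinomial s t x.1 x.2 =
      ∏ i ∈ Finset.Icc 1 (s + t), (Polynomial.X - Polynomial.C (a i)) ∧
    MonotoneOn (fun i => ‖a i‖) (Set.Icc 1 (s + t)) ∧
    ‖a j‖ ≠ ‖a (j + 1)‖}

/-- `Y` is a (strong) deformation retract of `X`: the identity of `X` is homotopic, relative to
`Y`, to a map of `X` into `Y`. -/
def IsDeformationRetract {E : Type*} [TopologicalSpace E] (X Y : Set E) : Prop :=
  Y ⊆ X ∧ ∃ r : C(X, X), (∀ x : X, (r x : E) ∈ Y) ∧
    ContinuousMap.HomotopicRel (ContinuousMap.id X) r {x : X | (x : E) ∈ Y}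

/-- Two closed curves in `M` are ambient isotopic: a continuous family of self-homeomorphisms of
`M`, starting at the identity, ends with one that carries the first curve to the second. -/
def AmbientIsotopic {M : Type*} [TopologicalSpace M] (f g : C(Circle, M)) : Prop :=
  ∃ H : C(I × M, M), (∀ l : I, IsHomeomorph (fun x : M => H (l, x))) ∧
    (∀ x : M, H (0, x) = x) ∧ ∀ u : Circle, H (1, f u) = g u

/-- The torus knot `K(m, n)` in its standard position on the torus `S¹ × S¹`:
the closed curve `u ↦ (u^n, u^m)`. -/
noncomputable def torusKnot (m n : ℕ) : C(Circle, Circle × Circle) where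
  toFun u := (u ^ n, u ^ m)
  continuous_toFun := by fun_prop

/-- A closed curve on `S¹ × S¹` is a torus knot `K(m, n)`: it is an embedded circle which is
ambient isotopic, within the torus, to the standard `K(m, n)`. (This is finer than being isotopic
to it in the 3-sphere, since isotopies of the standard torus extend to the 3-sphere.) -/
def IsTorusKnot (m n : ℕ) (γ : C(Circle, Circle × Circle)) : Prop :=
  Topology.IsEmbedding γ ∧ AmbientIsotopic (torusKnot m n) γ

/-- The point set in `ℂ × ℂ` traced by a closed curve on the unit torus
`{(p, q) | |p| = |q| = 1}`. -/
def trace (γ : C(Circle, Circle × Circle)) : Set (ℂ × ℂ) :=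
  Set.range fun u : Circle => (((γ u).1 : ℂ), ((γ u).2 : ℂ))

end Trinomials

/-! ### From deformation retracts to fundamental groups -/

namespace Trinomials

/-! Put n = s + t and δ = p^n / q^s. A root z yields u = z^n / q and v = p z^t / q with 1 + u + v =
0, and u determines z since p ≠ 0 and n, t are coprime. Distinct roots of equal norm share |u| and
|1 + u|, so their u's are conjugate, and δ = (-(1 + u))^n / u^t forces δ to be real. A double root
has u = t / s, so δ is real there too.

When δ is real, a rotation of the variable makes p and q real. Let k be the number of roots with |z|
< r. Conjugate pairs cancel in f(r) f(-r) = ∏ (a_i² - r²), which therefore has sign (-1)^k if no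
root lies on |z| = r. If none of the three terms of f dominates on this circle, the triangle
inequality ties the same sign to those of p and q. Dominance of the middle term would force k = t by
Rouché. Hence a circle with k ≠ t on which neither outer term dominates gives (-1)^(s+k) δ < 0
(`IsRootEnumeration.sign_of_radius`). A gap after a_j gives this with k = j; if |a_j| = |a_(j+1)|,
no third root has that norm, and a nearby circle gives it with k = j ± 1, which is the opposite
sign.

So U_j is the locus where (-1)^(s+j+1) δ avoids the negative real axis
(`rootNormGap_eq_slitRegion`). Scaling p and q radially to the unit torus, and for U_j also rotating
p until this number is positive, retracts each set onto a level curve of δ on the torus, which is a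
rotated torus knot. -/

open CategoryTheory in
/-- A homotopy equivalence induces isomorphisms of fundamental groups. -/
noncomputable def fundamentalGroupMulEquivOfHomotopyEquiv {X Y : Type*} [TopologicalSpace X]
    [TopologicalSpace Y] (e : ContinuousMap.HomotopyEquiv X Y) (x : X) :
    FundamentalGroup X x ≃* FundamentalGroup Y (e x) :=
  (FundamentalGroupoidFunctor.equivOfHomotopyEquiv e).fullyFaithfulFunctor.mulEquivEnd
    (FundamentalGroupoid.mk x)

theorem nonempty_fundamentalGroup_addCircle_mulEquiv (x : AddCircle (2 * Real.pi)) :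
    Nonempty (FundamentalGroup (AddCircle (2 * Real.pi)) x ≃* Multiplicative ℤ) := by
  obtain ⟨e, he⟩ := QuotientAddGroup.mk_surjective x
  have h := AddCircle.isAddQuotientCoveringMap_coe (2 * Real.pi)
  have hinf : addOrderOf (2 * Real.pi) = 0 := by
    rw [addOrderOf_eq_zero_iff']
    intro n hn h0
    have : (n : ℝ) * (2 * Real.pi) = 0 := by simpa using h0
    have hn' : (n : ℝ) ≠ 0 := by positivity
    have := Real.pi_ne_zero
    simp_all
  have e1 := h.fundamentalGroupEquiv (x := x) ⟨e, he⟩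
  -- The covering ℝ → ℝ/2πℤ yields the opposite of the period group; commutativity removes the
  -- opposite.
  have e2 : (Multiplicative (AddSubgroup.zmultiples (2 * Real.pi)))ᵐᵒᵖ ≃*
      Multiplicative (AddSubgroup.zmultiples (2 * Real.pi)) :=
    (MulOpposite.opMulEquiv (M := Multiplicative (AddSubgroup.zmultiples (2 * Real.pi)))).symm
  have hinj : Function.Injective (fun n : ℤ => n • (2 * Real.pi)) := by
    intro a b hab
    simpa [Real.pi_ne_zero] using hab
  have e3 : ℤ ≃+ AddSubgroup.zmultiples (2 * Real.pi) :=
    AddMonoidHom.ofInjective (f := zmultiplesHom ℝ (2 * Real.pi)) hinj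
  exact ⟨(e1.trans e2).trans (AddEquiv.toMultiplicative e3.symm)⟩

theorem nonempty_fundamentalGroup_circle_mulEquiv (x : Circle) :
    Nonempty (FundamentalGroup Circle x ≃* Multiplicative ℤ) :=
  (nonempty_fundamentalGroup_addCircle_mulEquiv _).map
    (fundamentalGroupMulEquivOfHomotopyEquiv
      AddCircle.homeomorphCircle'.symm.toHomotopyEquiv x).trans

theorem IsDeformationRetract.nonempty_homotopyEquiv {E : Type*} [TopologicalSpace E]
    {X Y : Set E} (h : IsDeformationRetract X Y) :
    Nonempty (ContinuousMap.HomotopyEquiv X Y) := by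
  obtain ⟨hYX, r, hr, ⟨F⟩⟩ := h
  let ι : C(Y, X) := ⟨Set.inclusion hYX, continuous_inclusion hYX⟩
  let ρ : C(X, Y) := ⟨fun x => ⟨r x, hr x⟩, by fun_prop⟩
  refine ⟨⟨ρ, ι, ⟨F.toHomotopy.symm⟩, ?_⟩⟩
  have : ρ.comp ι = ContinuousMap.id Y := by
    ext y
    have := F.fst_eq_snd (x := ι y) y.2
    exact congrArg (fun z : X => (z : E)) this.symm
  rw [this]

theorem isEmbedding_coe_prod : Topology.IsEmbedding
    (fun v : Circle × Circle => ((v.1 : ℂ), (v.2 : ℂ))) :=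
  Topology.IsEmbedding.subtypeVal.prodMap Topology.IsEmbedding.subtypeVal

theorem IsDeformationRetract.nonempty_homotopyEquiv_circle {X : Set (ℂ × ℂ)}
    {γ : C(Circle, Circle × Circle)} (hγ : Topology.IsEmbedding γ)
    (h : IsDeformationRetract X (trace γ)) : Nonempty (ContinuousMap.HomotopyEquiv X Circle) := by
  obtain ⟨e⟩ := h.nonempty_homotopyEquiv
  exact ⟨e.trans (isEmbedding_coe_prod.comp hγ).toHomeomorph.symm.toHomotopyEquiv⟩

theorem isConnected_of_isDeformationRetract {E : Type*} [TopologicalSpace E] {X Y : Set E}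
    (h : IsDeformationRetract X Y) (hY : IsConnected Y) : IsConnected X := by
  obtain ⟨hYX, r, hr, ⟨F⟩⟩ := h
  obtain ⟨y₀, hy₀⟩ := hY.nonempty
  refine ⟨⟨y₀, hYX hy₀⟩, isPreconnected_of_forall y₀ fun x hx => ?_⟩
  -- The track of `x` under the homotopy meets the connected set `Y` at its endpoint `r x`.
  refine ⟨Y ∪ Set.range (fun l : I => (F (l, ⟨x, hx⟩) : E)), ?_, .inl hy₀, .inr ⟨0, by simp⟩, ?_⟩
  · rintro z (hz | ⟨l, rfl⟩)
    · exact hYX hz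
    · exact (F (l, ⟨x, hx⟩)).2
  · refine IsPreconnected.union (r ⟨x, hx⟩ : E) (hr _) ⟨1, by simp⟩ hY.isPreconnected ?_
    exact isPreconnected_range (by fun_prop)

theorem topology_of_isDeformationRetract_trace {X : Set (ℂ × ℂ)}
    {γ : C(Circle, Circle × Circle)} (hγ : Topology.IsEmbedding γ)
    (h : IsDeformationRetract X (trace γ)) :
    IsConnected X ∧ ¬ IsSimplyConnected X ∧
      ∀ x : X, Nonempty (FundamentalGroup X x ≃* Multiplicative ℤ) := by
  have hconn : IsConnected X := isConnected_of_isDeformationRetract h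
    (isConnected_range (by fun_prop))
  obtain ⟨e⟩ := h.nonempty_homotopyEquiv_circle hγ
  have hπ : ∀ x : X, Nonempty (FundamentalGroup X x ≃* Multiplicative ℤ) := fun x =>
    (nonempty_fundamentalGroup_circle_mulEquiv (e x)).map
      (fundamentalGroupMulEquivOfHomotopyEquiv e x).trans
  refine ⟨hconn, fun hsc => ?_, hπ⟩
  have := hsc.simplyConnectedSpace
  obtain ⟨x, hx⟩ := hconn.nonempty
  obtain ⟨f⟩ := hπ ⟨x, hx⟩
  have : Subsingleton (Multiplicative ℤ) := f.symm.injective.subsingleton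
  exact not_subsingleton _ this

/-! ### Rotated torus knots -/

/-- The torus knot `K(m, n)`, rotated by `c` in the first coordinate. -/
noncomputable def rotatedTorusKnot (c : Circle) (m n : ℕ) : C(Circle, Circle × Circle) where
  toFun u := (c * u ^ n, u ^ m)
  continuous_toFun := by fun_prop

/-- Bézout coefficients recover the parameter as a Laurent monomial in the two coordinates, which is
a continuous left inverse. -/
theorem isEmbedding_rotatedTorusKnot (c : Circle) {m n : ℕ} (h : Nat.Coprime m n) :
    Topology.IsEmbedding (rotatedTorusKnot c m n) := by
  have hb : (m : ℤ) * m.gcdA n + n * m.gcdB n = 1 := by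
    rw [← Nat.gcd_eq_gcd_ab]; exact_mod_cast h
  have hg : Continuous
      (fun v : Circle × Circle => (c⁻¹ * v.1) ^ m.gcdB n * v.2 ^ m.gcdA n) :=
    .mul (.zpow (by fun_prop) _) (.zpow (by fun_prop) _)
  refine Topology.IsEmbedding.of_leftInverse (fun u => ?_) hg (by fun_prop)
  simp only [rotatedTorusKnot, ContinuousMap.coe_mk, inv_mul_cancel_left]
  rw [← zpow_natCast, ← zpow_natCast, ← zpow_mul, ← zpow_mul, ← zpow_add, add_comm, hb, zpow_one]

theorem isTorusKnot_rotatedTorusKnot (c : Circle) {m n : ℕ} (h : Nat.Coprime m n) :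
    IsTorusKnot m n (rotatedTorusKnot c m n) := by
  refine ⟨isEmbedding_rotatedTorusKnot c h, ?_⟩
  refine ⟨⟨fun v => (Circle.exp (v.1 * Complex.arg c) * v.2.1, v.2.2), by fun_prop⟩,
    fun l => ?_, fun x => by simp, fun u => ?_⟩
  · exact ((Homeomorph.mulLeft (Circle.exp (l * Complex.arg c))).prodCongr
      (Homeomorph.refl Circle)).isHomeomorph
  · simp [torusKnot, rotatedTorusKnot, Circle.exp_arg]

/-- This makes the knot a level curve of `v.1 ^ m / v.2 ^ n` on the unit torus. The same Bézout
monomial supplies the parameter of a point on it. -/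
theorem mem_trace_rotatedTorusKnot_iff {c : Circle} {m n : ℕ} (h : Nat.Coprime m n)
    (v : ℂ × ℂ) : v ∈ trace (rotatedTorusKnot c m n) ↔
      ‖v.1‖ = 1 ∧ ‖v.2‖ = 1 ∧ v.1 ^ m = (c : ℂ) ^ m * v.2 ^ n := by
  constructor
  · rintro ⟨u, rfl⟩
    simp only [rotatedTorusKnot, ContinuousMap.coe_mk, Circle.norm_coe, true_and]
    push_cast
    ring
  · rintro ⟨h1, h2, h3⟩
    obtain ⟨p, q⟩ := v
    obtain ⟨p, rfl⟩ : ∃ u : Circle, (u : ℂ) = p :=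
      ⟨⟨p, by simpa [Submonoid.unitSphere] using h1⟩, rfl⟩
    obtain ⟨q, rfl⟩ : ∃ u : Circle, (u : ℂ) = q :=
      ⟨⟨q, by simpa [Submonoid.unitSphere] using h2⟩, rfl⟩
    have hb : (m : ℤ) * m.gcdA n + n * m.gcdB n = 1 := by
      rw [← Nat.gcd_eq_gcd_ab]; exact_mod_cast h
    have h4 : (c⁻¹ * p) ^ m = q ^ n := by
      ext
      push_cast
      rw [mul_pow, h3, ← mul_assoc, ← mul_pow, inv_mul_cancel₀ (Circle.coe_ne_zero c)]
      simp
    refine ⟨(c⁻¹ * p) ^ m.gcdB n * q ^ m.gcdA n, ?_⟩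
    have e1 : ((c⁻¹ * p) ^ m.gcdB n * q ^ m.gcdA n) ^ n = c⁻¹ * p := by
      calc _ = (c⁻¹ * p) ^ (n * m.gcdB n) * (q ^ n) ^ m.gcdA n := by
            rw [mul_pow, ← zpow_natCast, ← zpow_natCast, ← zpow_natCast, ← zpow_mul, ← zpow_mul,
              ← zpow_mul, mul_comm (m.gcdB n), mul_comm (m.gcdA n)]
        _ = _ := by
            rw [← h4, ← zpow_natCast, ← zpow_mul, ← zpow_add, add_comm, hb, zpow_one]
    have e2 : ((c⁻¹ * p) ^ m.gcdB n * q ^ m.gcdA n) ^ m = q := by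
      calc _ = ((c⁻¹ * p) ^ m) ^ (m.gcdB n) * q ^ (m * m.gcdA n) := by
            rw [mul_pow, ← zpow_natCast, ← zpow_natCast, ← zpow_natCast, ← zpow_mul, ← zpow_mul,
              ← zpow_mul, mul_comm (m.gcdB n), mul_comm (m.gcdA n)]
        _ = _ := by
            rw [h4, ← zpow_natCast, ← zpow_mul, ← zpow_add, add_comm, hb, zpow_one]
    simp only [rotatedTorusKnot, ContinuousMap.coe_mk, e1, e2, mul_inv_cancel_left]

end Trinomials

/-! ### Radial retractions onto the unit torus -/

namespace Trinomials

/-- The flow that moves a pair of nonzero complex numbers radially to the unit torus, rotating the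
first coordinate through the angle `-θ` at the same time. -/
noncomputable def radialFlow (θ : ℝ) (l : ℝ) (x : ℂ × ℂ) : ℂ × ℂ :=
  (((‖x.1‖ ^ (-l) : ℝ) : ℂ) * x.1 * Complex.exp (-(l * θ : ℝ) * Complex.I),
    ((‖x.2‖ ^ (-l) : ℝ) : ℂ) * x.2)

theorem radialFlow_zero (θ : ℝ) (x : ℂ × ℂ) : radialFlow θ 0 x = x := by
  simp [radialFlow]

theorem norm_radialFlow_one {θ : ℝ} {x : ℂ × ℂ} (hx : x ∈ parameterSpace) :
    ‖(radialFlow θ 1 x).1‖ = 1 ∧ ‖(radialFlow θ 1 x).2‖ = 1 := by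
  have h1 := norm_ne_zero_iff.2 hx.1
  have h2 := norm_ne_zero_iff.2 hx.2
  have h3 : ‖Complex.exp (-(1 * θ : ℝ) * Complex.I)‖ = 1 := by
    simpa using Complex.norm_exp_ofReal_mul_I (-(1 * θ))
  constructor
  · simp only [radialFlow, norm_mul, h3, Complex.norm_real, norm_norm, mul_one, Real.rpow_neg_one,
      norm_inv, inv_mul_cancel₀ h1]
  · simp only [radialFlow, norm_mul, Complex.norm_real, norm_norm, Real.rpow_neg_one,
      norm_inv, inv_mul_cancel₀ h2]

theorem radialFlow_eq_self {θ l : ℝ} {x : ℂ × ℂ} (h1 : ‖x.1‖ = 1) (h2 : ‖x.2‖ = 1) (hθ : θ = 0) :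
    radialFlow θ l x = x := by
  simp [radialFlow, h1, h2, hθ]

/-- Up to a positive factor, the flow multiplies `p ^ m / q ^ k` by `exp (-l m θ i)`. -/
theorem exists_invariant_radialFlow (m k : ℕ) (θ l : ℝ) {x : ℂ × ℂ} (hx : x ∈ parameterSpace) :
    ∃ ρ : ℝ, 0 < ρ ∧ (radialFlow θ l x).1 ^ m / (radialFlow θ l x).2 ^ k =
      ρ * (Complex.exp (-(l * (m * θ) : ℝ) * Complex.I) * (x.1 ^ m / x.2 ^ k)) := by
  have h1 := norm_pos_iff.2 hx.1
  have h2 := norm_pos_iff.2 hx.2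
  refine ⟨(‖x.1‖ ^ (-l)) ^ m / (‖x.2‖ ^ (-l)) ^ k, by positivity, ?_⟩
  simp only [radialFlow, mul_pow, ← Complex.exp_nat_mul]
  push_cast
  rw [show (m : ℂ) * (-(l * θ) * Complex.I) = -(l * (m * θ)) * Complex.I by ring]
  ring

theorem radialFlow_mem_parameterSpace {θ l : ℝ} {x : ℂ × ℂ} (hx : x ∈ parameterSpace) :
    radialFlow θ l x ∈ parameterSpace := by
  have h1 := norm_pos_iff.2 hx.1
  have h2 := norm_pos_iff.2 hx.2
  have h3 : ((‖x.1‖ ^ (-l) : ℝ) : ℂ) ≠ 0 := by exact_mod_cast (Real.rpow_pos_of_pos h1 _).ne'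
  have h4 : ((‖x.2‖ ^ (-l) : ℝ) : ℂ) ≠ 0 := by exact_mod_cast (Real.rpow_pos_of_pos h2 _).ne'
  exact ⟨mul_ne_zero (mul_ne_zero h3 hx.1) (Complex.exp_ne_zero _), mul_ne_zero h4 hx.2⟩

theorem isDeformationRetract_of_radialFlow {X Y : Set (ℂ × ℂ)} (hX : X ⊆ parameterSpace)
    (hYX : Y ⊆ X) (θ : X → ℝ) (hθ : Continuous θ)
    (hmem : ∀ (x : X) (l : I), radialFlow (θ x) l x ∈ X)
    (hone : ∀ x : X, radialFlow (θ x) 1 x ∈ Y)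
    (hY : ∀ x : X, (x : ℂ × ℂ) ∈ Y →
      ‖(x : ℂ × ℂ).1‖ = 1 ∧ ‖(x : ℂ × ℂ).2‖ = 1 ∧ θ x = 0) :
    IsDeformationRetract X Y := by
  have hcont : Continuous fun z : I × X => radialFlow (θ z.2) z.1 z.2 := by
    have hp : Continuous fun z : I × X => ((‖(z.2 : ℂ × ℂ).1‖ ^ (-(z.1 : ℝ)) : ℝ) : ℂ) :=
      Complex.continuous_ofReal.comp (Continuous.rpow (by fun_prop) (by fun_prop)
        fun z => .inl (norm_ne_zero_iff.2 (hX z.2.2).1))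
    have hq : Continuous fun z : I × X => ((‖(z.2 : ℂ × ℂ).2‖ ^ (-(z.1 : ℝ)) : ℝ) : ℂ) :=
      Complex.continuous_ofReal.comp (Continuous.rpow (by fun_prop) (by fun_prop)
        fun z => .inl (norm_ne_zero_iff.2 (hX z.2.2).2))
    have hθ' : Continuous fun z : I × X => θ z.2 := hθ.comp continuous_snd
    unfold radialFlow
    fun_prop
  let F : C(I × X, X) :=
    ⟨fun z => ⟨radialFlow (θ z.2) z.1 z.2, hmem z.2 z.1⟩, hcont.subtype_mk _⟩
  refine ⟨hYX, ⟨fun x => F (1, x), by fun_prop⟩, fun x => by simpa [F] using hone x,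
    ⟨⟨⟨F, ?_, ?_⟩, ?_⟩⟩⟩
  · intro x
    ext1
    simp [F, radialFlow_zero]
  · intro x
    rfl
  · intro l x hx
    obtain ⟨h1, h2, h3⟩ := hY x hx
    ext1
    simp [F, radialFlow_eq_self h1 h2 h3]

theorem real_mul_mem_slitPlane_iff {ρ : ℝ} (hρ : 0 < ρ) (z : ℂ) :
    (ρ : ℂ) * z ∈ Complex.slitPlane ↔ z ∈ Complex.slitPlane := by
  simp [Complex.mem_slitPlane_iff, hρ, hρ.ne']

theorem exists_circle_pow_eq (c : ℂ) (hc : ‖c‖ = 1) {m : ℕ} (hm : m ≠ 0) :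
    ∃ w : Circle, (w : ℂ) ^ m = c := by
  obtain ⟨z, hz⟩ := IsAlgClosed.exists_pow_nat_eq c (Nat.pos_of_ne_zero hm)
  have : ‖z‖ = 1 := by
    rw [← pow_eq_one_iff_of_nonneg (norm_nonneg z) hm, ← norm_pow, hz, hc]
  exact ⟨⟨z, by simpa [Submonoid.unitSphere] using this⟩, hz⟩

/-- The parameters for which `c p ^ m / q ^ k` is not a negative real number. -/
def slitRegion (c : ℂ) (m k : ℕ) : Set (ℂ × ℂ) :=
  {x ∈ parameterSpace | c * (x.1 ^ m / x.2 ^ k) ∈ Complex.slitPlane}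

/-- The parameters for which `c p ^ m / q ^ k` is a negative real number. -/
def slitRay (c : ℂ) (m k : ℕ) : Set (ℂ × ℂ) :=
  {x ∈ parameterSpace | c * (x.1 ^ m / x.2 ^ k) ∉ Complex.slitPlane}

/-- Radial scaling preserves the argument of the invariant, so no rotation is needed. On the unit
torus a number on the negative ray is -1, whence the choice of `w`. -/
theorem exists_isDeformationRetract_slitRay {c : ℂ} (hc : ‖c‖ = 1) {m k : ℕ} (hm : m ≠ 0)
    (h : Nat.Coprime m k) : ∃ γ : C(Circle, Circle × Circle), IsTorusKnot m k γ ∧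
      IsDeformationRetract (slitRay c m k) (trace γ) := by
  have hc0 : c ≠ 0 := norm_ne_zero_iff.1 (by simp [hc])
  obtain ⟨w, hw⟩ := exists_circle_pow_eq (-c⁻¹) (by simp [hc]) hm
  refine ⟨_, isTorusKnot_rotatedTorusKnot w h, ?_⟩
  have key : ∀ x : ℂ × ℂ, x ∈ trace (rotatedTorusKnot w m k) ↔
      x ∈ slitRay c m k ∧ ‖x.1‖ = 1 ∧ ‖x.2‖ = 1 := by
    intro x
    rw [mem_trace_rotatedTorusKnot_iff h, hw]
    constructor
    · rintro ⟨h1, h2, h3⟩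
      have h10 : x.1 ≠ 0 := norm_ne_zero_iff.1 (by simp [h1])
      have h20 : x.2 ≠ 0 := norm_ne_zero_iff.1 (by simp [h2])
      refine ⟨⟨⟨h10, h20⟩, ?_⟩, h1, h2⟩
      rw [h3, show c * (-c⁻¹ * x.2 ^ k / x.2 ^ k) = -1 by field_simp]
      simp [Complex.mem_slitPlane_iff]
    · rintro ⟨⟨hx, hs⟩, h1, h2⟩
      refine ⟨h1, h2, ?_⟩
      have hn : ‖c * (x.1 ^ m / x.2 ^ k)‖ = 1 := by simp [h1, h2, hc]
      have h20 := hx.2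
      set z := c * (x.1 ^ m / x.2 ^ k) with hz
      have hz1 : z = -1 := by
        rw [Complex.mem_slitPlane_iff] at hs
        push Not at hs
        have hr : z = (z.re : ℂ) := Complex.ext (by simp) (by simp [hs.2])
        rw [hr, Complex.norm_real, Real.norm_eq_abs, abs_of_nonpos hs.1] at hn
        rw [hr, show z.re = -1 by linarith]
        simp
      rw [hz1] at hz
      field_simp at hz ⊢
      linear_combination -hz
  have hmem : ∀ (x : slitRay c m k) (l : ℝ), radialFlow 0 l x ∈ slitRay c m k := by
    refine fun x l => ⟨radialFlow_mem_parameterSpace x.2.1, ?_⟩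
    obtain ⟨ρ, hρ, he⟩ := exists_invariant_radialFlow m k 0 l x.2.1
    rw [he, mul_left_comm, real_mul_mem_slitPlane_iff hρ]
    simpa using x.2.2
  exact isDeformationRetract_of_radialFlow (fun x hx => hx.1) (fun x hx => ((key x).1 hx).1)
    (fun _ => 0) continuous_const (fun x l => hmem x l)
    (fun x => (key _).2 ⟨hmem x 1, norm_radialFlow_one x.2.1⟩)
    fun x hx => ⟨((key x).1 hx).2.1, ((key x).1 hx).2.2, rfl⟩

/-- With angle `arg / m`, the flow multiplies the argument of the invariant by `1 - l`. It thus
stays in the slit plane, where `arg` is continuous, and reaches 1 at time one. -/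
theorem exists_isDeformationRetract_slitRegion {c : ℂ} (hc : ‖c‖ = 1) {m k : ℕ} (hm : m ≠ 0)
    (h : Nat.Coprime m k) : ∃ γ : C(Circle, Circle × Circle), IsTorusKnot m k γ ∧
      IsDeformationRetract (slitRegion c m k) (trace γ) := by
  have hc0 : c ≠ 0 := norm_ne_zero_iff.1 (by simp [hc])
  have hm' : (m : ℝ) ≠ 0 := Nat.cast_ne_zero.2 hm
  obtain ⟨w, hw⟩ := exists_circle_pow_eq c⁻¹ (by simp [hc]) hm
  refine ⟨_, isTorusKnot_rotatedTorusKnot w h, ?_⟩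
  have key : ∀ x : ℂ × ℂ, x ∈ trace (rotatedTorusKnot w m k) →
      x ∈ parameterSpace ∧ c * (x.1 ^ m / x.2 ^ k) = 1 ∧ ‖x.1‖ = 1 ∧ ‖x.2‖ = 1 := by
    intro x
    rw [mem_trace_rotatedTorusKnot_iff h, hw]
    rintro ⟨h1, h2, h3⟩
    have h10 : x.1 ≠ 0 := norm_ne_zero_iff.1 (by simp [h1])
    have h20 : x.2 ≠ 0 := norm_ne_zero_iff.1 (by simp [h2])
    refine ⟨⟨h10, h20⟩, ?_, h1, h2⟩
    rw [h3]
    field_simp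
  have polar : ∀ (x : slitRegion c m k) (l : ℝ), ∃ r : ℝ, 0 < r ∧
      c * ((radialFlow (Complex.arg (c * (x.1.1 ^ m / x.1.2 ^ k)) / m) l x).1 ^ m /
        (radialFlow (Complex.arg (c * (x.1.1 ^ m / x.1.2 ^ k)) / m) l x).2 ^ k) =
      r * Complex.exp (((1 - l) * Complex.arg (c * (x.1.1 ^ m / x.1.2 ^ k)) : ℝ) *
        Complex.I) := by
    intro x l
    obtain ⟨ρ, hρ, he⟩ := exists_invariant_radialFlow m k
      (Complex.arg (c * (x.1.1 ^ m / x.1.2 ^ k)) / m) l x.2.1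
    refine ⟨ρ * ‖c * (x.1.1 ^ m / x.1.2 ^ k)‖,
      mul_pos hρ (norm_pos_iff.2 (Complex.slitPlane_ne_zero x.2.2)), ?_⟩
    rw [he, mul_div_cancel₀ _ hm', mul_left_comm, mul_left_comm c]
    set z := c * (x.1.1 ^ m / x.1.2 ^ k)
    have hz : Complex.exp (-(l * z.arg : ℝ) * Complex.I) * z =
        ‖z‖ * Complex.exp (((1 - l) * z.arg : ℝ) * Complex.I) := by
      conv_lhs => rw [← congrArg (Complex.exp (-(l * z.arg : ℝ) * Complex.I) * ·)
        (Complex.norm_mul_exp_arg_mul_I z)]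
      rw [mul_left_comm, ← Complex.exp_add]
      congr 2
      push_cast
      ring
    rw [hz]
    push_cast
    ring
  refine isDeformationRetract_of_radialFlow (fun x hx => hx.1) (fun x hx => ?_)
    (fun x => Complex.arg (c * (x.1.1 ^ m / x.1.2 ^ k)) / m) ?_ (fun x l => ?_) (fun x => ?_)
    fun x hx => ?_
  · obtain ⟨h1, h2, -⟩ := key x hx
    refine ⟨h1, ?_⟩
    rw [h2]
    exact Complex.one_mem_slitPlane
  · have h1 : Continuous fun x : slitRegion c m k => c * (x.1.1 ^ m / x.1.2 ^ k) :=
      continuous_const.mul (Continuous.div (by fun_prop) (by fun_prop)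
        fun x => pow_ne_zero _ x.2.1.2)
    exact Continuous.div_const (continuous_iff_continuousAt.2 fun x =>
      (Complex.continuousAt_arg x.2.2).comp
        (f := fun x : slitRegion c m k => c * (x.1.1 ^ m / x.1.2 ^ k)) h1.continuousAt) _
  · refine ⟨radialFlow_mem_parameterSpace x.2.1, ?_⟩
    obtain ⟨r, hr, he⟩ := polar x l
    rw [he, real_mul_mem_slitPlane_iff hr, Complex.mem_slitPlane_iff_arg]
    refine ⟨?_, Complex.exp_ne_zero _⟩
    have h1 := Complex.neg_pi_lt_arg (c * (x.1.1 ^ m / x.1.2 ^ k))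
    have h2 := lt_of_le_of_ne (Complex.arg_le_pi _) (Complex.slitPlane_arg_ne_pi x.2.2)
    set φ := Complex.arg (c * (x.1.1 ^ m / x.1.2 ^ k))
    have h3 := l.2.1
    have h4 := l.2.2
    have h5 : (1 - l) * φ < Real.pi := by nlinarith [Real.pi_pos]
    have h6 : -Real.pi < (1 - l) * φ := by nlinarith [Real.pi_pos]
    rw [Complex.arg_exp_mul_I, (toIocMod_eq_self _).2 ⟨h6, by linarith⟩]
    exact h5.ne
  · rw [mem_trace_rotatedTorusKnot_iff h, hw]
    obtain ⟨h1, h2⟩ := norm_radialFlow_one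
      (θ := Complex.arg (c * (x.1.1 ^ m / x.1.2 ^ k)) / m) x.2.1
    refine ⟨h1, h2, ?_⟩
    obtain ⟨r, hr, he⟩ := polar x 1
    have h3 := (radialFlow_mem_parameterSpace
      (θ := Complex.arg (c * (x.1.1 ^ m / x.1.2 ^ k)) / m) (l := 1) x.2.1).2
    set y := radialFlow (Complex.arg (c * (x.1.1 ^ m / x.1.2 ^ k)) / m) 1 x
    simp only [sub_self, zero_mul, Complex.ofReal_zero, Complex.exp_zero, mul_one] at he
    have hr1 : r = 1 := by
      have := congrArg norm he
      simpa [h1, h2, hc, abs_of_pos hr] using this.symm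
    rw [hr1, Complex.ofReal_one] at he
    field_simp at he ⊢
    linear_combination he
  · obtain ⟨-, h2, h3, h4⟩ := key x hx
    simp [h2, h3, h4]

end Trinomials

/-! ### Roots of equal norm -/

namespace Trinomials

open Polynomial ComplexConjugate

theorem eval_trinomial (s t : ℕ) (p q z : ℂ) :
    (trinomial s t p q).eval z = z ^ (s + t) + p * z ^ t + q := by
  simp [trinomial]

/-- Two circles with centers 0 and -1 meet in a pair of points symmetric about the real axis. -/
theorem eq_or_eq_conj_of_norm_eq {u w : ℂ} (h : ‖u‖ = ‖w‖) (h' : ‖1 + u‖ = ‖1 + w‖) :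
    w = u ∨ w = conj u := by
  have e1 : Complex.normSq u = Complex.normSq w := by
    rw [Complex.normSq_eq_norm_sq, Complex.normSq_eq_norm_sq, h]
  have e2 : Complex.normSq (1 + u) = Complex.normSq (1 + w) := by
    rw [Complex.normSq_eq_norm_sq, Complex.normSq_eq_norm_sq, h']
  simp only [Complex.normSq_apply, Complex.add_re, Complex.add_im, Complex.one_re,
    Complex.one_im, zero_add] at e1 e2
  have hre : w.re = u.re := by linarith
  have him : w.im ^ 2 = u.im ^ 2 := by nlinarith
  rcases sq_eq_sq_iff_eq_or_eq_neg.1 him with h | h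
  · exact .inl (Complex.ext hre h)
  · exact .inr (Complex.ext (by simpa using hre) (by simpa using h))

theorem eq_of_pow_eq_of_coprime {z w : ℂ} (hw : w ≠ 0) {m k : ℕ} (h : Nat.Coprime m k)
    (hm : z ^ m = w ^ m) (hk : z ^ k = w ^ k) : z = w := by
  have h1 : (z / w) ^ m = 1 := by rw [div_pow, hm, div_self (pow_ne_zero _ hw)]
  have h2 : (z / w) ^ k = 1 := by rw [div_pow, hk, div_self (pow_ne_zero _ hw)]
  have h3 : (z / w) ^ (m.gcd k) = 1 := pow_gcd_eq_one.2 ⟨h1, h2⟩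
  rw [h, pow_one] at h3
  exact (div_eq_one_iff_eq hw).1 h3

variable {s t : ℕ} {p q : ℂ}

theorem ne_zero_of_isRoot (ht : 0 < t) (hq : q ≠ 0) {z : ℂ}
    (hz : z ^ (s + t) + p * z ^ t + q = 0) : z ≠ 0 := by
  rintro rfl
  simp [ht.ne'] at hz
  exact hq hz

theorem eq_of_pow_div_eq (ht : 0 < t) (hst : Nat.Coprime s t) (hp : p ≠ 0)
    (hq : q ≠ 0) {z w : ℂ} (hz : z ^ (s + t) + p * z ^ t + q = 0)
    (hw : w ^ (s + t) + p * w ^ t + q = 0) (h : z ^ (s + t) / q = w ^ (s + t) / q) : z = w := by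
  have h1 : z ^ (s + t) = w ^ (s + t) := by field_simp at h; exact h
  have h2 : z ^ t = w ^ t := mul_left_cancel₀ hp (by linear_combination hz - hw - h1)
  exact eq_of_pow_eq_of_coprime (ne_zero_of_isRoot ht hq hw) (by simpa using hst) h1 h2

theorem one_add_pow_div (hq : q ≠ 0) {z : ℂ} (hz : z ^ (s + t) + p * z ^ t + q = 0) :
    1 + z ^ (s + t) / q = -(p * z ^ t / q) := by
  field_simp
  linear_combination hz

/-- Two distinct roots of the same norm are exchanged by complex conjugation, up to a rotation. -/
theorem pow_div_eq_conj_of_norm_eq (ht : 0 < t) (hst : Nat.Coprime s t) (hp : p ≠ 0)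
    (hq : q ≠ 0) {z w : ℂ} (hz : z ^ (s + t) + p * z ^ t + q = 0)
    (hw : w ^ (s + t) + p * w ^ t + q = 0) (h : ‖z‖ = ‖w‖) (hne : z ≠ w) :
    w ^ (s + t) / q = conj (z ^ (s + t) / q) := by
  refine (eq_or_eq_conj_of_norm_eq (by simp [h]) ?_).resolve_left
    fun h' => hne (eq_of_pow_div_eq ht hst hp hq hz hw h'.symm)
  rw [one_add_pow_div hq hz, one_add_pow_div hq hw]
  simp [h]

/-- The Euler operator is diagonal on monomials, so no exponent `k - 1` has to be handled. -/
theorem X_mul_derivative_C_mul_X_pow (c : ℂ) (k : ℕ) :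
    X * derivative (C c * X ^ k) = C (c * k) * X ^ k := by
  rcases k with _ | k
  · simp
  · rw [derivative_C_mul_X_pow, Nat.add_sub_cancel, pow_succ]
    ring

theorem X_mul_derivative_trinomial :
    X * derivative (trinomial s t p q) =
      C ((s + t : ℕ) : ℂ) * X ^ (s + t) + C (p * t) * X ^ t := by
  have h1 := X_mul_derivative_C_mul_X_pow 1 (s + t)
  have h2 := X_mul_derivative_C_mul_X_pow p t
  simp only [map_one, one_mul] at h1
  rw [trinomial, derivative_add, derivative_add, derivative_C, add_zero, mul_add, h1, h2]

theorem X_mul_derivative_X_mul_derivative_trinomial :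
    X * derivative (X * derivative (trinomial s t p q)) =
      C (((s + t : ℕ) : ℂ) * (s + t : ℕ)) * X ^ (s + t) + C (p * t * t) * X ^ t := by
  rw [X_mul_derivative_trinomial, derivative_add, mul_add, X_mul_derivative_C_mul_X_pow,
    X_mul_derivative_C_mul_X_pow]

theorem pow_dvd_X_mul_derivative {f : ℂ[X]} {z : ℂ} {k : ℕ} (h : (X - C z) ^ (k + 1) ∣ f) :
    (X - C z) ^ k ∣ X * derivative f :=
  Dvd.dvd.mul_left (by simpa using pow_sub_one_dvd_derivative_of_pow_dvd h) _

/-- At a double root, z f'(z) - t f(z) = s z^(s+t) - t q vanishes. -/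
theorem pow_div_of_sq_dvd (hs : 0 < s) (hq : q ≠ 0) {z : ℂ}
    (hz : z ^ (s + t) + p * z ^ t + q = 0) (h : (X - C z) ^ 2 ∣ trinomial s t p q) :
    z ^ (s + t) / q = ((t / s : ℝ) : ℂ) := by
  have h1 := pow_dvd_X_mul_derivative h
  rw [pow_one, dvd_iff_isRoot, X_mul_derivative_trinomial, IsRoot.def] at h1
  simp at h1
  have hs' : (s : ℂ) ≠ 0 := Nat.cast_ne_zero.2 hs.ne'
  push_cast
  field_simp
  linear_combination h1 - t * hz

/-- At a triple root the first two iterates of the Euler operator vanish as well; eliminating the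
z^t term leaves s (s + t) z^(s+t) = 0. -/
theorem not_cube_dvd_trinomial (hs : 0 < s) (ht : 0 < t) (hq : q ≠ 0) (z : ℂ) :
    ¬ (X - C z) ^ 3 ∣ trinomial s t p q := by
  intro h
  have hz : z ^ (s + t) + p * z ^ t + q = 0 := by
    rw [← eval_trinomial, ← IsRoot.def, ← dvd_iff_isRoot]
    exact (dvd_pow_self _ (by norm_num)).trans h
  have h1 := pow_dvd_X_mul_derivative h
  have h2 := pow_dvd_X_mul_derivative h1
  rw [pow_one, dvd_iff_isRoot, X_mul_derivative_X_mul_derivative_trinomial, IsRoot.def] at h2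
  replace h1 := (dvd_pow_self _ (by norm_num)).trans h1
  rw [dvd_iff_isRoot, X_mul_derivative_trinomial, IsRoot.def] at h1
  simp at h1 h2
  have hs' : (s : ℂ) ≠ 0 := Nat.cast_ne_zero.2 hs.ne'
  have hn : (s + t : ℂ) ≠ 0 := by exact_mod_cast (by omega : s + t ≠ 0)
  have h3 : s * (s + t : ℂ) * z ^ (s + t) = 0 := by linear_combination h2 - t * h1
  have := ne_zero_of_isRoot ht hq hz
  simp_all

/-- An enumeration of the roots of a trinomial, with multiplicity. -/
def IsRootEnumeration (s t : ℕ) (p q : ℂ) (a : ℕ → ℂ) : Prop :=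
  trinomial s t p q = ∏ i ∈ Finset.Icc 1 (s + t), (X - C (a i))

variable {a : ℕ → ℂ}

theorem IsRootEnumeration.isRoot (ha : IsRootEnumeration s t p q a) {i : ℕ}
    (hi : i ∈ Finset.Icc 1 (s + t)) : a i ^ (s + t) + p * a i ^ t + q = 0 := by
  rw [← eval_trinomial, ha, eval_prod]
  exact Finset.prod_eq_zero hi (by simp)

theorem IsRootEnumeration.pow_card_dvd (ha : IsRootEnumeration s t p q a) {z : ℂ}
    {T : Finset ℕ} (hT : T ⊆ Finset.Icc 1 (s + t)) (h : ∀ i ∈ T, a i = z) :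
    (X - C z) ^ T.card ∣ trinomial s t p q := by
  rw [ha, ← Finset.prod_const]
  refine (Finset.prod_congr rfl fun i hi => ?_).dvd.trans
    (Finset.prod_dvd_prod_of_subset T _ (fun i => X - C (a i)) hT)
  rw [h i hi]

/-- For two roots of the same norm, one of which may be a double root, `z ^ n / q` and
`w ^ n / q` are conjugate, and they are either nonreal or equal to `t / s`. -/
theorem IsRootEnumeration.conj_of_norm_eq (ha : IsRootEnumeration s t p q a) (hs : 0 < s)
    (ht : 0 < t) (hst : Nat.Coprime s t) (hp : p ≠ 0) (hq : q ≠ 0) {i k : ℕ}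
    (hi : i ∈ Finset.Icc 1 (s + t)) (hk : k ∈ Finset.Icc 1 (s + t)) (hik : i ≠ k)
    (h : ‖a i‖ = ‖a k‖) :
    a k ^ (s + t) / q = conj (a i ^ (s + t) / q) ∧
      ((a i ^ (s + t) / q).im ≠ 0 ∨ a i ^ (s + t) / q = ((t / s : ℝ) : ℂ)) := by
  by_cases hne : a i = a k
  · have h2 : a i ^ (s + t) / q = ((t / s : ℝ) : ℂ) := by
      refine pow_div_of_sq_dvd hs hq (ha.isRoot hi) ?_
      rw [← Finset.card_pair hik]
      exact ha.pow_card_dvd (by simp [Finset.insert_subset_iff, hi, hk]) (by simp [hne])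
    exact ⟨by rw [← hne, h2, Complex.conj_ofReal], .inr h2⟩
  · have h1 := pow_div_eq_conj_of_norm_eq ht hst hp hq (ha.isRoot hi) (ha.isRoot hk) h hne
    refine ⟨h1, .inl fun h0 => hne ?_⟩
    rw [Complex.conj_eq_iff_im.2 h0] at h1
    exact eq_of_pow_div_eq ht hst hp hq (ha.isRoot hi) (ha.isRoot hk) h1.symm

/-- No circle around the origin contains three roots. -/
theorem IsRootEnumeration.not_three_norm_eq (ha : IsRootEnumeration s t p q a) (hs : 0 < s)
    (ht : 0 < t) (hst : Nat.Coprime s t) (hp : p ≠ 0) (hq : q ≠ 0) {i k l : ℕ}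
    (hi : i ∈ Finset.Icc 1 (s + t)) (hk : k ∈ Finset.Icc 1 (s + t))
    (hl : l ∈ Finset.Icc 1 (s + t)) (hik : i ≠ k) (hkl : k ≠ l) (hil : i ≠ l)
    (h : ‖a i‖ = ‖a k‖) (h' : ‖a k‖ = ‖a l‖) : False := by
  have e1 := (ha.conj_of_norm_eq hs ht hst hp hq hi hk hik h).1
  have e2 := (ha.conj_of_norm_eq hs ht hst hp hq hk hl hkl h').1
  have e3 := (ha.conj_of_norm_eq hs ht hst hp hq hi hl hil (h.trans h')).1
  -- Pairwise conjugacy of three numbers makes them all equal, so the three indices give a triple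
  -- root.
  have hkl' := eq_of_pow_div_eq ht hst hp hq (ha.isRoot hk) (ha.isRoot hl) (e1.trans e3.symm)
  rw [e1, Complex.conj_conj] at e2
  have hil' := eq_of_pow_div_eq ht hst hp hq (ha.isRoot hl) (ha.isRoot hi) e2
  refine not_cube_dvd_trinomial (p := p) hs ht hq (a i) ?_
  have hc : ({i, k, l} : Finset ℕ).card = 3 := Finset.card_eq_three.2 ⟨i, k, l, hik, hil, hkl, rfl⟩
  rw [← hc]
  exact ha.pow_card_dvd (by simp [Finset.insert_subset_iff, hi, hk, hl])
    (by simp [hkl', hil'])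

theorem invariant_eq_div (ht : 0 < t) (hq : q ≠ 0) {z : ℂ}
    (hz : z ^ (s + t) + p * z ^ t + q = 0) :
    p ^ (s + t) / q ^ s =
      (-(1 + z ^ (s + t) / q)) ^ (s + t) / (z ^ (s + t) / q) ^ t := by
  have := ne_zero_of_isRoot ht hq hz
  rw [one_add_pow_div hq hz, neg_neg, div_pow, div_pow, mul_pow, ← pow_mul, ← pow_mul,
    mul_comm t, pow_add q]
  field_simp

/-- The invariant is a rational function of u with real coefficients, evaluated here at u and at its
conjugate. -/
theorem IsRootEnumeration.invariant_im_eq_zero (ha : IsRootEnumeration s t p q a) (hs : 0 < s)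
    (ht : 0 < t) (hst : Nat.Coprime s t) (hp : p ≠ 0) (hq : q ≠ 0) {i k : ℕ}
    (hi : i ∈ Finset.Icc 1 (s + t)) (hk : k ∈ Finset.Icc 1 (s + t)) (hik : i ≠ k)
    (h : ‖a i‖ = ‖a k‖) : (p ^ (s + t) / q ^ s).im = 0 := by
  have e1 := (ha.conj_of_norm_eq hs ht hst hp hq hi hk hik h).1
  rw [← Complex.conj_eq_iff_im]
  conv_lhs => rw [invariant_eq_div ht hq (ha.isRoot hi)]
  rw [invariant_eq_div ht hq (ha.isRoot hk), e1]
  simp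

/-- For nonreal u the triangle with sides 1, u, v is nondegenerate. At a double root u = t / s > 0
and |v| = 1 + |u|, so only the outer terms satisfy a strict inequality. Strictness lets the bounds
persist on nearby circles. -/
theorem IsRootEnumeration.norm_lt_of_norm_eq (ha : IsRootEnumeration s t p q a) (hs : 0 < s)
    (ht : 0 < t) (hst : Nat.Coprime s t) (hp : p ≠ 0) (hq : q ≠ 0) {i k : ℕ}
    (hi : i ∈ Finset.Icc 1 (s + t)) (hk : k ∈ Finset.Icc 1 (s + t)) (hik : i ≠ k)
    (h : ‖a i‖ = ‖a k‖) :
    ‖q‖ < ‖a i‖ ^ (s + t) + ‖p‖ * ‖a i‖ ^ t ∧ ‖a i‖ ^ (s + t) < ‖p‖ * ‖a i‖ ^ t + ‖q‖ := by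
  have e1 := (ha.conj_of_norm_eq hs ht hst hp hq hi hk hik h).2
  have e2 := one_add_pow_div hq (ha.isRoot hi)
  have hq' := norm_pos_iff.2 hq
  set u := a i ^ (s + t) / q with hu
  set v := p * a i ^ t / q with hv
  have hun : ‖u‖ = ‖a i‖ ^ (s + t) / ‖q‖ := by simp [hu]
  have hvn : ‖v‖ = ‖p‖ * ‖a i‖ ^ t / ‖q‖ := by simp [hv]
  suffices h : 1 < ‖u‖ + ‖v‖ ∧ ‖u‖ < ‖v‖ + 1 by
    rw [hun, hvn] at h
    constructor
    · have := (lt_div_iff₀ hq').1 (h.1.trans_eq (add_div _ _ _).symm)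
      linarith
    · have := h.2
      rw [div_lt_iff₀ hq'] at this
      rwa [add_mul, div_mul_cancel₀ _ hq'.ne', one_mul] at this
  have hre := congrArg Complex.re e2
  have him := congrArg Complex.im e2
  simp at hre him
  rcases e1 with e1 | e1
  · have h1 := Complex.abs_re_lt_norm.2 e1
    have h2 : v.im ≠ 0 := fun h0 => e1 (by simp [him, h0])
    have h3 := Complex.abs_re_lt_norm.2 h2
    rw [abs_lt] at h1 h3
    refine ⟨by linarith, ?_⟩
    refine lt_of_pow_lt_pow_left₀ 2 (by positivity) ?_
    have e3 := Complex.sq_norm u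
    have e4 := Complex.sq_norm v
    rw [Complex.normSq_apply] at e3 e4
    have hre' : u.re = -v.re - 1 := by linarith
    rw [hre', him] at e3
    nlinarith
  · have hs' : (0 : ℝ) < s := Nat.cast_pos.2 hs
    have ht' : (0 : ℝ) < t := Nat.cast_pos.2 ht
    have hts : 0 < (t / s : ℝ) := by positivity
    have h1 : v = -((1 + t / s : ℝ) : ℂ) := by
      rw [e1] at e2
      push_cast at e2 ⊢
      linear_combination e2
    rw [h1, e1, norm_neg, Complex.norm_real, Complex.norm_real, Real.norm_of_nonneg hts.le,
      Real.norm_of_nonneg (by positivity)]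
    constructor <;> linarith

end Trinomials

/-! ### Counting roots in a disc: Rouché and parity -/

namespace Trinomials

open Polynomial ComplexConjugate

/-- Rouché's theorem for a product of linear factors and a monomial. -/
theorem card_norm_lt_eq_of_monomial_dominates {T : Finset ℕ} {a : ℕ → ℂ} {c : ℂ} {t : ℕ} {r : ℝ}
    (hr : 0 < r)
    (h : ∀ z : ℂ, ‖z‖ = r → ‖∏ i ∈ T, (z - a i) - c * z ^ t‖ < ‖c * z ^ t‖) :
    (T.filter fun i => ‖a i‖ < r).card = t := by
  have hmon : ∀ z : ℂ, ‖z‖ = r → c * z ^ t ≠ 0 := fun z hz =>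
    norm_pos_iff.1 ((norm_nonneg _).trans_lt (h z hz))
  have hprod : ∀ z : ℂ, ‖z‖ = r → ∏ i ∈ T, (z - a i) ≠ 0 := by
    intro z hz h0
    have := h z hz
    simp [h0] at this
  have hfac : ∀ z : ℂ, ‖z‖ = r → ∀ i ∈ T, z - a i ≠ 0 := fun z hz =>
    Finset.prod_ne_zero_iff.1 (hprod z hz)
  have hne : ∀ i ∈ T, ‖a i‖ ≠ r := fun i hi h' => hfac (a i) h' i hi (sub_self _)
  let H : ℂ → ℂ := fun z => (∏ i ∈ T, (z - a i)) / (c * z ^ t)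
  -- On the circle |H - 1| < 1, so `log H` is a primitive of the logarithmic derivative. Its
  -- integral therefore vanishes, and the residues count the roots inside against `t`.
  have hlog : ∀ z : ℂ, ‖z‖ = r →
      HasDerivAt (fun z => Complex.log (H z)) (∑ i ∈ T, (z - a i)⁻¹ - t * (z - 0)⁻¹) z := by
    intro z hz
    have hz0 : z ≠ 0 := norm_pos_iff.1 (hz ▸ hr)
    have hslit : H z ∈ Complex.slitPlane := by
      have h1 : ‖H z - 1‖ < 1 := by
        rw [show H z - 1 = (∏ i ∈ T, (z - a i) - c * z ^ t) / (c * z ^ t) by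
          simp only [H]; rw [sub_div, div_self (hmon z hz)], norm_div,
          div_lt_one (norm_pos_iff.2 (hmon z hz))]
        exact h z hz
      simpa using Complex.mem_slitPlane_of_norm_lt_one h1
    have hd1 : DifferentiableAt ℂ (fun z => ∏ i ∈ T, (z - a i)) z :=
      DifferentiableAt.fun_finsetProd fun i _ => by fun_prop
    have hd2 : DifferentiableAt ℂ (fun z : ℂ => c * z ^ t) z := by fun_prop
    have hd : DifferentiableAt ℂ H z := hd1.fun_div hd2 (hmon z hz)
    have h1 := hd.hasDerivAt.clog hslit
    have hc : c ≠ 0 := left_ne_zero_of_mul (hmon z hz)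
    have h2 : deriv H z / H z = ∑ i ∈ T, (z - a i)⁻¹ - t * (z - 0)⁻¹ := by
      rw [← logDeriv_apply, logDeriv_div z (hprod z hz) (hmon z hz) hd1 hd2,
        logDeriv_prod (hfac z hz) (fun i _ => by fun_prop), logDeriv_const_mul z c hc]
      congr 1
      · refine Finset.sum_congr rfl fun i _ => ?_
        simp [logDeriv_apply]
      · rw [logDeriv_fun_pow (by fun_prop)]
        simp
    rw [← h2]
    exact h1
  have hint : ∀ w : ℂ, ‖w‖ ≠ r → CircleIntegrable (fun z => (z - w)⁻¹) 0 r := by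
    intro w hw
    rw [circleIntegrable_sub_inv_iff]
    right
    simpa [abs_of_pos hr] using hw
  have hI := circleIntegral.integral_eq_zero_of_hasDerivWithinAt hr.le
    fun z (hz : z ∈ Metric.sphere (0 : ℂ) r) => (hlog z (by simpa using hz)).hasDerivWithinAt
  have hint0 : CircleIntegrable (fun z => (t : ℂ) * (z - 0)⁻¹) 0 r :=
    IntervalIntegrable.const_mul (hint 0 (by simpa using hr.ne)) _
  rw [circleIntegral.integral_sub (CircleIntegrable.fun_sum _ fun i hi => hint _ (hne i hi)) hint0,
    circleIntegral.integral_fun_sum fun i hi => hint _ (hne i hi),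
    circleIntegral.integral_const_mul, circleIntegral.integral_sub_center_inv _ hr.ne'] at hI
  have hterm : ∀ i ∈ T, (∮ z in C(0, r), (z - a i)⁻¹) =
      if ‖a i‖ < r then 2 * Real.pi * Complex.I else 0 := by
    intro i hi
    split_ifs with hlt
    · exact circleIntegral.integral_sub_inv_of_mem_ball (by simpa using hlt)
    · have hgt : r < ‖a i‖ := lt_of_le_of_ne (not_lt.1 hlt) (hne i hi).symm
      refine Complex.circleIntegral_eq_zero_of_differentiable_on_off_countable hr.le
        Set.countable_empty ?_ ?_
      · refine ContinuousOn.inv₀ (by fun_prop) fun z hz h0 => ?_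
        have : ‖z‖ ≤ r := by simpa using hz
        rw [sub_eq_zero.1 h0] at this
        linarith
      · intro z hz
        refine DifferentiableAt.fun_inv (by fun_prop) fun h0 => ?_
        have : ‖z‖ < r := by simpa using hz.1
        rw [sub_eq_zero.1 h0] at this
        linarith
  rw [Finset.sum_congr rfl hterm, ← Finset.sum_filter, Finset.sum_const, nsmul_eq_mul,
    ← sub_mul] at hI
  have := (mul_eq_zero.1 hI).resolve_right (by simp [Real.pi_ne_zero])
  exact_mod_cast sub_eq_zero.1 this

/-- A conjugate pair contributes |h z|², so only real elements could affect the sign. -/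
theorem exists_pos_prod_eq_of_map_conj_eq {M : Multiset ℂ} (hM : M.map conj = M) {h : ℂ → ℂ}
    (hconj : ∀ z, h (conj z) = conj (h z)) (hne : ∀ z ∈ M, h z ≠ 0)
    (hreal : ∀ x : ℝ, (x : ℂ) ∈ M → ∃ ρ : ℝ, 0 < ρ ∧ h x = ρ) :
    ∃ ρ : ℝ, 0 < ρ ∧ (M.map h).prod = ρ := by
  have hlt : M.filter (fun z => z.im < 0) = (M.filter fun z => 0 < z.im).map conj := by
    conv_lhs => rw [← hM]
    rw [Multiset.filter_map]
    simp
  have hsplit : M = M.filter (fun z => z.im = 0) +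
      (M.filter (fun z => 0 < z.im) + M.filter (fun z => z.im < 0)) := by
    conv_lhs => rw [← Multiset.filter_add_not (fun z => z.im = 0) M,
      ← Multiset.filter_add_not (fun z => 0 < z.im) (M.filter fun z => ¬ z.im = 0)]
    rw [Multiset.filter_filter, Multiset.filter_filter]
    congr 2 <;> refine Multiset.filter_congr fun z _ => ?_
    · exact ⟨fun h => h.1, fun h => ⟨h, h.ne'⟩⟩
    · exact ⟨fun h => lt_of_le_of_ne (not_lt.1 h.1) h.2, fun h => ⟨h.not_gt, h.ne⟩⟩
  have h1 : ∀ M' : Multiset ℂ, (∀ z ∈ M', ∃ ρ : ℝ, 0 < ρ ∧ h z = ρ) →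
      ∃ ρ : ℝ, 0 < ρ ∧ (M'.map h).prod = ρ := by
    intro M'
    induction M' using Multiset.induction with
    | empty => exact fun _ => ⟨1, one_pos, by simp⟩
    | cons z M' ih =>
      intro hz
      obtain ⟨ρ, hρ, e⟩ := hz z (by simp)
      obtain ⟨ρ', hρ', e'⟩ := ih fun w hw => hz w (by simp [hw])
      exact ⟨ρ * ρ', mul_pos hρ hρ', by simp [e, e']⟩
  obtain ⟨ρ, hρ, e⟩ := h1 (M.filter fun z => z.im = 0) fun z hz => by
    rw [Multiset.mem_filter] at hz
    have hz' : z = (z.re : ℂ) := Complex.ext rfl (by simpa using hz.2)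
    rw [hz'] at hz ⊢
    exact hreal _ hz.1
  have hpos : ((M.filter fun z => 0 < z.im).map h).prod ≠ 0 := by
    refine Multiset.prod_ne_zero fun h0 => ?_
    obtain ⟨z, hz, e⟩ := Multiset.mem_map.1 h0
    exact hne z (Multiset.mem_filter.1 hz).1 e
  refine ⟨ρ * Complex.normSq ((M.filter fun z => 0 < z.im).map h).prod,
    mul_pos hρ (Complex.normSq_pos.2 hpos), ?_⟩
  conv_lhs => rw [hsplit]
  rw [Multiset.map_add, Multiset.map_add, Multiset.prod_add, Multiset.prod_add, hlt, e,
    Multiset.map_map, Complex.ofReal_mul, ← Complex.mul_conj, map_multiset_prod,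
    Multiset.map_map]
  simp [hconj]

/-- Inside the disc r² - z² is positive at real z, outside z² - r² is; each element inside costs one
sign. -/
theorem prod_sq_sub_sq_eq {M : Multiset ℂ} (hM : M.map conj = M) {r : ℝ} (hr : 0 < r)
    (hne : ∀ z ∈ M, ‖z‖ ≠ r) :
    ∃ ρ : ℝ, 0 < ρ ∧ (M.map fun z => z ^ 2 - (r : ℂ) ^ 2).prod =
      (-1) ^ (M.filter fun z => ‖z‖ < r).card * (ρ : ℂ) := by
  have hne' : ∀ z ∈ M, z ^ 2 - (r : ℂ) ^ 2 ≠ 0 := by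
    intro z hz h0
    have h1 : ‖z‖ ^ 2 = r ^ 2 := by
      rw [← norm_pow, sub_eq_zero.1 h0, norm_pow, Complex.norm_real, Real.norm_of_nonneg hr.le]
    exact hne z hz ((pow_left_inj₀ (norm_nonneg z) hr.le two_ne_zero).1 h1)
  have hf : ∀ (P : ℝ → Prop) [DecidablePred P],
      (M.filter fun z => P ‖z‖).map conj = M.filter fun z => P ‖z‖ := by
    intro P _
    conv_rhs => rw [← hM]
    rw [Multiset.filter_map]
    simp
  obtain ⟨ρ, hρ, e⟩ := exists_pos_prod_eq_of_map_conj_eq (hf (· < r))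
    (h := fun z => (r : ℂ) ^ 2 - z ^ 2) (by simp)
    (fun z hz h0 => hne' z (Multiset.mem_filter.1 hz).1 (by linear_combination -h0))
    (fun x hx => ⟨r ^ 2 - x ^ 2, by
      have := (Multiset.mem_filter.1 hx).2
      rw [Complex.norm_real, Real.norm_eq_abs] at this
      have := sq_lt_sq' (neg_lt_of_abs_lt this) (lt_of_abs_lt this)
      linarith, by push_cast; ring⟩)
  obtain ⟨ρ', hρ', e'⟩ := exists_pos_prod_eq_of_map_conj_eq (hf (¬ · < r))
    (h := fun z => z ^ 2 - (r : ℂ) ^ 2) (by simp)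
    (fun z hz h0 => hne' z (Multiset.mem_filter.1 hz).1 h0)
    (fun x hx => ⟨x ^ 2 - r ^ 2, by
      have h1 := (Multiset.mem_filter.1 hx).2
      have h2 := hne _ (Multiset.mem_filter.1 hx).1
      rw [Complex.norm_real, Real.norm_eq_abs] at h1 h2
      have h3 : r < |x| := lt_of_le_of_ne (not_lt.1 h1) h2.symm
      have := pow_lt_pow_left₀ h3 hr.le two_ne_zero
      rw [sq_abs] at this
      linarith, by push_cast; ring⟩)
  refine ⟨ρ * ρ', mul_pos hρ hρ', ?_⟩
  conv_lhs => rw [← Multiset.filter_add_not (fun z => ‖z‖ < r) M]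
  have hneg : (M.filter fun z => ‖z‖ < r).map (fun z => z ^ 2 - (r : ℂ) ^ 2) =
      ((M.filter fun z => ‖z‖ < r).map (fun z => (r : ℂ) ^ 2 - z ^ 2)).map Neg.neg := by simp
  rw [Multiset.map_add, Multiset.prod_add, e', hneg, Multiset.prod_map_neg, Multiset.card_map, e]
  push_cast
  ring

variable {s t : ℕ} {p q : ℝ} {a : ℕ → ℂ}

theorem IsRootEnumeration.map_conj (ha : IsRootEnumeration s t p q a) :
    ((Finset.Icc 1 (s + t)).val.map a).map conj = (Finset.Icc 1 (s + t)).val.map a := by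
  have h1 : (trinomial s t p q).map (starRingEnd ℂ) = trinomial s t p q := by
    simp [trinomial]
  have h2 := h1
  rw [ha, Polynomial.map_prod] at h2
  simp only [Polynomial.map_sub, map_X, map_C] at h2
  refine (roots_multiset_prod_X_sub_C _).symm.trans (.trans ?_ (roots_multiset_prod_X_sub_C _))
  rw [Multiset.map_map, Multiset.map_map, Multiset.map_map]
  exact congrArg roots h2

/-- For a trinomial with real coefficients, the parity of the number of roots of norm less than `r`
can be read off from the values at `r` and `-r`. -/
theorem IsRootEnumeration.neg_one_pow_card_mul_pos (ha : IsRootEnumeration s t p q a) {r : ℝ}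
    (hr : 0 < r) (hne : ∀ i ∈ Finset.Icc 1 (s + t), ‖a i‖ ≠ r) :
    0 < (-1) ^ ((Finset.Icc 1 (s + t)).filter fun i => ‖a i‖ < r).card *
      ((r ^ (s + t) + p * r ^ t + q) * ((-r) ^ (s + t) + p * (-r) ^ t + q)) := by
  obtain ⟨ρ, hρ, e⟩ := prod_sq_sub_sq_eq ha.map_conj hr (by
    intro z hz
    obtain ⟨i, hi, rfl⟩ := Multiset.mem_map.1 hz
    exact hne i hi)
  have hev : ∀ x : ℝ, ((x ^ (s + t) + p * x ^ t + q : ℝ) : ℂ) =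
      ∏ i ∈ Finset.Icc 1 (s + t), ((x : ℂ) - a i) := by
    intro x
    have := eval_trinomial s t p q x
    rw [ha, eval_prod] at this
    simpa using this.symm
  have h1 : (((r ^ (s + t) + p * r ^ t + q) * ((-r) ^ (s + t) + p * (-r) ^ t + q) : ℝ) : ℂ) =
      (-1) ^ ((Finset.Icc 1 (s + t)).filter fun i => ‖a i‖ < r).card * ρ := by
    rw [Complex.ofReal_mul, hev, hev, ← Finset.prod_mul_distrib]
    rw [Multiset.filter_map, Multiset.card_map, Multiset.map_map] at e
    refine Eq.trans (Finset.prod_congr rfl (g := fun i => a i ^ 2 - (r : ℂ) ^ 2) fun i _ => ?_) e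
    push_cast
    ring
  have h2 : (r ^ (s + t) + p * r ^ t + q) * ((-r) ^ (s + t) + p * (-r) ^ t + q) =
      (-1) ^ ((Finset.Icc 1 (s + t)).filter fun i => ‖a i‖ < r).card * ρ := by
    exact_mod_cast h1
  rw [h2, ← mul_assoc, ← mul_pow]
  simpa using hρ

/-- |x + y| is |x| + |y| ≥ |z| for equal signs and ||x| - |y|| ≤ |z| for opposite signs. -/
theorem mul_mul_sq_sub_sq_pos {x y z : ℝ} (hx : |x| ≤ |y| + |z|) (hy : |y| ≤ |x| + |z|)
    (hz : |z| ≤ |x| + |y|) (hx0 : x ≠ 0) (hy0 : y ≠ 0) (h : (x + y) ^ 2 - z ^ 2 ≠ 0) :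
    0 < x * y * ((x + y) ^ 2 - z ^ 2) := by
  rcases lt_or_gt_of_ne (mul_ne_zero hx0 hy0) with hxy | hxy
  · refine mul_pos_of_neg_of_neg hxy (lt_of_le_of_ne (sub_nonpos.2 (sq_le_sq.2 ?_)) h)
    rcases mul_neg_iff.1 hxy with ⟨h1, h2⟩ | ⟨h1, h2⟩
    · rw [abs_of_pos h1, abs_of_neg h2] at *
      rw [abs_le]
      constructor <;> linarith
    · rw [abs_of_pos h2, abs_of_neg h1] at *
      rw [abs_le]
      constructor <;> linarith
  · refine mul_pos hxy (lt_of_le_of_ne (sub_nonneg.2 (sq_le_sq.2 ?_)) h.symm)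
    rwa [(abs_add_eq_add_abs_iff x y).2 ?_]
    rcases mul_pos_iff.1 hxy with ⟨h1, h2⟩ | ⟨h1, h2⟩
    · exact .inl ⟨h1.le, h2.le⟩
    · exact .inr ⟨h1.le, h2.le⟩

/-- If none of the three terms dominates on the circle of radius `r`, then the signs of the values
at `r` and `-r` are determined by the signs of the coefficients. -/
theorem neg_one_pow_mul_values_neg (hst : Nat.Coprime s t) (hp : p ≠ 0) (hq : q ≠ 0) {r : ℝ}
    (hr : 0 < r) (h0 : |q| ≤ r ^ (s + t) + |p| * r ^ t) (ht : |p| * r ^ t ≤ r ^ (s + t) + |q|)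
    (hn : r ^ (s + t) ≤ |p| * r ^ t + |q|)
    (hne : (r ^ (s + t) + p * r ^ t + q) * ((-r) ^ (s + t) + p * (-r) ^ t + q) ≠ 0) :
    (-1) ^ s * (p ^ (s + t) * q ^ s) *
      ((r ^ (s + t) + p * r ^ t + q) * ((-r) ^ (s + t) + p * (-r) ^ t + q)) < 0 := by
  obtain ⟨A, hA⟩ : ∃ A, A = r ^ (s + t) := ⟨_, rfl⟩
  obtain ⟨B, hB⟩ : ∃ B, B = p * r ^ t := ⟨_, rfl⟩
  have hApos : 0 < A := hA ▸ pow_pos hr _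
  have hB0 : B ≠ 0 := hB ▸ mul_ne_zero hp (pow_pos hr _).ne'
  have hBabs : |p| * r ^ t = |B| := by rw [hB, abs_mul, abs_of_pos (pow_pos hr t)]
  rw [hBabs, ← hA, ← abs_of_pos hApos] at h0 ht hn
  have hpB : p * B = p ^ 2 * r ^ t := by rw [hB]; ring
  have hpB' : 0 < p * B := by rw [hpB]; positivity
  -- In each parity case the product of values is a difference of squares: two of A, B, q keep their
  -- relative sign at -r, and the third changes sign relative to them. Both exponents even
  -- contradicts coprimality.
  rcases Nat.even_or_odd s with hs' | hs' <;> rcases Nat.even_or_odd t with ht' | ht'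
  · have h2 := Nat.dvd_gcd hs'.two_dvd ht'.two_dvd
    rw [hst] at h2
    norm_num at h2
  · rw [(hs'.add_odd ht').neg_pow, ht'.neg_pow, mul_neg, ← hA, ← hB] at hne ⊢
    have h1 := mul_mul_sq_sub_sq_pos (x := A) (y := B) (z := q) (by linarith) (by linarith)
      (by linarith) hApos.ne' hB0 (by intro h; apply hne; linear_combination -h)
    have h2 : 0 < p ^ (s + t) * B := by
      obtain ⟨k, hk⟩ := hs'.add_odd ht'
      rw [hk, pow_succ, mul_assoc]
      exact mul_pos ((even_two_mul k).pow_pos hp) hpB'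
    have h3 := hs'.pow_pos hq
    rw [hs'.neg_one_pow]
    have h4 : 0 < (p ^ (s + t) * B) * q ^ s * (A * B * ((A + B) ^ 2 - q ^ 2)) :=
      mul_pos (mul_pos h2 h3) h1
    have h5 : 0 < A * B ^ 2 := by positivity
    refine neg_of_mul_pos_left (b := -(A * B ^ 2)) ?_ (by linarith)
    linarith
  · rw [(hs'.add_even ht').neg_pow, ht'.neg_pow, ← hA, ← hB] at hne ⊢
    have h1 := mul_mul_sq_sub_sq_pos (x := B) (y := q) (z := A) (by linarith) (by linarith)
      (by linarith) hB0 hq (by intro h; apply hne; linear_combination h)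
    have h2 : 0 < p ^ (s + t) * B := by
      obtain ⟨k, hk⟩ := hs'.add_even ht'
      rw [hk, pow_succ, mul_assoc]
      exact mul_pos ((even_two_mul k).pow_pos hp) hpB'
    have h3 : 0 < q ^ s * q := by
      rw [← pow_succ]
      exact hs'.add_one.pow_pos hq
    rw [hs'.neg_one_pow]
    have h4 : 0 < (p ^ (s + t) * B) * (q ^ s * q) * (B * q * ((B + q) ^ 2 - A ^ 2)) :=
      mul_pos (mul_pos h2 h3) h1
    have h5 : 0 < (B * q) ^ 2 := by positivity
    refine neg_of_mul_pos_left (b := -(B * q) ^ 2) ?_ (by linarith)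
    linarith
  · rw [(hs'.add_odd ht').neg_pow, ht'.neg_pow, mul_neg, ← hA, ← hB] at hne ⊢
    have h1 := mul_mul_sq_sub_sq_pos (x := A) (y := q) (z := B) (by linarith) (by linarith)
      (by linarith) hApos.ne' hq (by intro h; apply hne; linear_combination h)
    have h2 : 0 < p ^ (s + t) := (hs'.add_odd ht').pow_pos hp
    have h3 : 0 < q ^ s * q := by
      rw [← pow_succ]
      exact hs'.add_one.pow_pos hq
    rw [hs'.neg_one_pow]
    have h4 : 0 < p ^ (s + t) * (q ^ s * q) * (A * q * ((A + q) ^ 2 - B ^ 2)) :=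
      mul_pos (mul_pos h2 h3) h1
    have h5 : 0 < A * q ^ 2 := by positivity
    refine neg_of_mul_pos_left (b := -(A * q ^ 2)) ?_ (by linarith)
    linarith

end Trinomials

/-! ### The sign criterion for real coefficients -/

namespace Trinomials

open Polynomial ComplexConjugate Filter Topology

section RealCoefficients

variable {s t : ℕ} {p q : ℝ} {a : ℕ → ℂ}

theorem IsRootEnumeration.sign_of_radius (ha : IsRootEnumeration s t p q a)
    (hst : Nat.Coprime s t) (hp : p ≠ 0) (hq : q ≠ 0) {r : ℝ} (hr : 0 < r)
    (h0 : |q| ≤ r ^ (s + t) + |p| * r ^ t) (hn : r ^ (s + t) ≤ |p| * r ^ t + |q|) {k : ℕ}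
    (hlt : ∀ i ∈ Finset.Icc 1 k, ‖a i‖ < r) (hgt : ∀ i ∈ Finset.Icc (k + 1) (s + t), r < ‖a i‖)
    (hk : k ≤ s + t) (hkt : k ≠ t) : (-1) ^ (s + k) * (p ^ (s + t) * q ^ s) < 0 := by
  have hcard : ((Finset.Icc 1 (s + t)).filter fun i => ‖a i‖ < r).card = k := by
    have : ((Finset.Icc 1 (s + t)).filter fun i => ‖a i‖ < r) = Finset.Icc 1 k := by
      ext i
      simp only [Finset.mem_filter, Finset.mem_Icc] at *
      refine ⟨fun h => ⟨h.1.1, ?_⟩, fun h => ⟨⟨h.1, h.2.trans hk⟩, hlt i h⟩⟩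
      by_contra! hki
      exact (hgt i ⟨hki, h.1.2⟩).not_gt h.2
    simp [this]
  have hne : ∀ i ∈ Finset.Icc 1 (s + t), ‖a i‖ ≠ r := by
    intro i hi
    rw [Finset.mem_Icc] at hi
    rcases le_or_gt i k with h | h
    · exact (hlt i (Finset.mem_Icc.2 ⟨hi.1, h⟩)).ne
    · exact (hgt i (Finset.mem_Icc.2 ⟨h, hi.2⟩)).ne'
  -- Otherwise Rouché would place exactly `t` roots in the disc. This is where `k ≠ t` enters.
  have ht : |p| * r ^ t ≤ r ^ (s + t) + |q| := by
    by_contra! hdom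
    refine hkt (hcard ▸ card_norm_lt_eq_of_monomial_dominates (c := p) hr fun z hz => ?_)
    have h1 := eval_trinomial s t p q z
    rw [ha, eval_prod] at h1
    simp only [eval_sub, eval_X, eval_C] at h1
    rw [h1, show z ^ (s + t) + p * z ^ t + q - p * z ^ t = z ^ (s + t) + q by ring]
    calc _ ≤ ‖z ^ (s + t)‖ + ‖(q : ℂ)‖ := norm_add_le _ _
      _ < _ := by simpa [hz] using hdom
  have h1 := ha.neg_one_pow_card_mul_pos hr hne
  rw [hcard] at h1
  set V := (r ^ (s + t) + p * r ^ t + q) * ((-r) ^ (s + t) + p * (-r) ^ t + q) with hV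
  have h2 := neg_one_pow_mul_values_neg hst hp hq hr h0 ht hn (right_ne_zero_of_mul h1.ne')
  rw [← hV] at h2
  have h3 := mul_neg_of_neg_of_pos h2 h1
  have h4 : 0 < V ^ 2 := by
    have := right_ne_zero_of_mul h1.ne'
    positivity
  refine neg_of_mul_neg_left (b := V ^ 2) ?_ h4.le
  rw [pow_add]
  linarith

theorem IsRootEnumeration.sign_of_norm_lt (ha : IsRootEnumeration s t p q a)
    (hst : Nat.Coprime s t) (hp : p ≠ 0) (hq : q ≠ 0)
    (hmono : MonotoneOn (fun i => ‖a i‖) (Set.Icc 1 (s + t))) {j : ℕ} (hj : 1 ≤ j)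
    (hj' : j + 1 ≤ s + t) (hjt : j ≠ t) (h : ‖a j‖ < ‖a (j + 1)‖) :
    (-1) ^ (s + j) * (p ^ (s + t) * q ^ s) < 0 := by
  obtain ⟨r, hr1, hr2⟩ := exists_between h
  have hr : 0 < r := (norm_nonneg _).trans_lt hr1
  have hroot : ∀ i ∈ Finset.Icc 1 (s + t), (a i) ^ (s + t) + p * (a i) ^ t + q = 0 :=
    fun i hi => ha.isRoot hi
  have hlt : ∀ i ∈ Finset.Icc 1 j, ‖a i‖ < r := fun i hi => by
    rw [Finset.mem_Icc] at hi
    exact (hmono ⟨hi.1, by omega⟩ ⟨hj, by omega⟩ hi.2).trans_lt hr1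
  have hgt : ∀ i ∈ Finset.Icc (j + 1) (s + t), r < ‖a i‖ := fun i hi => by
    rw [Finset.mem_Icc] at hi
    exact hr2.trans_le (hmono ⟨by omega, hj'⟩ ⟨by omega, hi.2⟩ hi.1)
  refine ha.sign_of_radius hst hp hq hr ?_ ?_ hlt hgt (by omega) hjt
  -- The constant term cannot dominate, because the innermost root lies inside the circle.
  · have h1 := hlt 1 (Finset.mem_Icc.2 ⟨le_rfl, hj⟩)
    have h2 := hroot 1 (Finset.mem_Icc.2 ⟨le_rfl, by omega⟩)
    calc |q| = ‖(q : ℂ)‖ := by simp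
      _ = ‖a 1 ^ (s + t) + p * a 1 ^ t‖ := by
        rw [← norm_neg]
        congr 1
        linear_combination -h2
      _ ≤ ‖a 1‖ ^ (s + t) + |p| * ‖a 1‖ ^ t := (norm_add_le _ _).trans_eq (by simp)
      _ ≤ _ := by gcongr
  -- If the leading term dominated at `r`, it would dominate at every larger radius, including that
  -- of the outermost root: (x^s - |p|) x^t increases once it is positive.
  · by_contra! hdom
    have h1 := hgt (s + t) (Finset.mem_Icc.2 ⟨hj', le_rfl⟩)
    have h2 := hroot (s + t) (Finset.mem_Icc.2 ⟨by omega, le_rfl⟩)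
    set R := ‖a (s + t)‖
    have h3 : R ^ (s + t) ≤ |p| * R ^ t + |q| := by
      calc R ^ (s + t) = ‖a (s + t) ^ (s + t)‖ := by simp [R]
        _ = ‖(p * a (s + t) ^ t + q : ℂ)‖ := by
          rw [← norm_neg]
          congr 1
          linear_combination -h2
        _ ≤ _ := (norm_add_le _ _).trans_eq (by simp [R])
    have h4 : 0 < (r ^ s - |p|) * r ^ t := by
      rw [pow_add] at hdom
      linarith [abs_nonneg q]
    have h5 : 0 < r ^ s - |p| := pos_of_mul_pos_left h4 (by positivity)
    have h6 : r ^ s ≤ R ^ s := by gcongr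
    have h7 : (r ^ s - |p|) * r ^ t ≤ (R ^ s - |p|) * R ^ t :=
      mul_le_mul (by linarith) (by gcongr) (by positivity) (by linarith)
    rw [pow_add] at h3 hdom
    linarith

/-- Circles slightly larger and slightly smaller than |a_j| enclose j + 1 and j - 1 roots. Both
counts have parity opposite to j, and at least one differs from t. -/
theorem IsRootEnumeration.sign_of_norm_eq (ha : IsRootEnumeration s t p q a) (hs : 0 < s)
    (ht : 0 < t) (hst : Nat.Coprime s t) (hp : p ≠ 0) (hq : q ≠ 0)
    (hmono : MonotoneOn (fun i => ‖a i‖) (Set.Icc 1 (s + t))) {j : ℕ} (hj : 1 ≤ j)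
    (hj' : j + 1 ≤ s + t) (h : ‖a j‖ = ‖a (j + 1)‖) :
    0 < (-1) ^ (s + j) * (p ^ (s + t) * q ^ s) := by
  have hpc : (p : ℂ) ≠ 0 := by exact_mod_cast hp
  have hqc : (q : ℂ) ≠ 0 := by exact_mod_cast hq
  have hmj : j ∈ Finset.Icc 1 (s + t) := Finset.mem_Icc.2 ⟨hj, by omega⟩
  have hmj' : j + 1 ∈ Finset.Icc 1 (s + t) := Finset.mem_Icc.2 ⟨by omega, hj'⟩
  obtain ⟨b0, bn⟩ := ha.norm_lt_of_norm_eq hs ht hst hpc hqc hmj hmj' (by omega) h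
  have hr : 0 < ‖a j‖ := norm_pos_iff.2 (ne_zero_of_isRoot ht hqc (ha.isRoot hmj))
  have hbelow : ∀ i ∈ Finset.Icc 1 (j - 1), ‖a i‖ < ‖a j‖ := fun i hi => by
    rw [Finset.mem_Icc] at hi
    refine lt_of_le_of_ne (hmono ⟨hi.1, by omega⟩ ⟨hj, by omega⟩ (by omega)) fun h' => ?_
    exact ha.not_three_norm_eq hs ht hst hpc hqc (Finset.mem_Icc.2 ⟨hi.1, by omega⟩) hmj hmj'
      (by omega) (by omega) (by omega) h' h
  have habove : ∀ i ∈ Finset.Icc (j + 2) (s + t), ‖a j‖ < ‖a i‖ := fun i hi => by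
    rw [Finset.mem_Icc] at hi
    refine lt_of_le_of_ne (hmono ⟨hj, by omega⟩ ⟨by omega, hi.2⟩ (by omega)) fun h' => ?_
    exact ha.not_three_norm_eq hs ht hst hpc hqc hmj hmj' (Finset.mem_Icc.2 ⟨by omega, hi.2⟩)
      (by omega) (by omega) (by omega) h (h ▸ h')
  simp only [Complex.norm_real, Real.norm_eq_abs] at b0 bn
  have ev0 : ∀ᶠ x in 𝓝 ‖a j‖, |q| < x ^ (s + t) + |p| * x ^ t :=
    ContinuousAt.eventually_lt continuousAt_const (by fun_prop) b0
  have evn : ∀ᶠ x in 𝓝 ‖a j‖, x ^ (s + t) < |p| * x ^ t + |q| :=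
    ContinuousAt.eventually_lt (by fun_prop) (by fun_prop) bn
  have evpos := lt_mem_nhds hr
  by_cases hjt : j - 1 = t
  · have ev : ∀ᶠ x in 𝓝 ‖a j‖, ∀ i ∈ Finset.Icc (j + 2) (s + t), x < ‖a i‖ :=
      (Finset.eventually_all _).2 fun i hi => gt_mem_nhds (habove i hi)
    obtain ⟨x, ⟨⟨⟨h1, h2⟩, h3⟩, h4⟩, hx⟩ :=
      ((((ev0.and evn).and evpos).and ev).filter_mono nhdsWithin_le_nhds |>.and
        (self_mem_nhdsWithin (s := Set.Ioi ‖a j‖))).exists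
    have h5 := ha.sign_of_radius hst hp hq (k := j + 1) h3 h1.le h2.le (fun i hi => by
      rw [Finset.mem_Icc] at hi
      exact ((hmono ⟨hi.1, by omega⟩ ⟨by omega, hj'⟩ hi.2).trans_eq h.symm).trans_lt hx) h4
      hj' (by omega)
    rw [← add_assoc, pow_succ] at h5
    linarith
  · have ev : ∀ᶠ x in 𝓝 ‖a j‖, ∀ i ∈ Finset.Icc 1 (j - 1), ‖a i‖ < x :=
      (Finset.eventually_all _).2 fun i hi => lt_mem_nhds (hbelow i hi)
    obtain ⟨x, ⟨⟨⟨h1, h2⟩, h3⟩, h4⟩, hx⟩ :=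
      ((((ev0.and evn).and evpos).and ev).filter_mono nhdsWithin_le_nhds |>.and
        (self_mem_nhdsWithin (s := Set.Iio ‖a j‖))).exists
    have h5 := ha.sign_of_radius hst hp hq (k := j - 1) h3 h1.le h2.le h4 (fun i hi => by
      rw [Finset.mem_Icc] at hi
      exact lt_of_lt_of_le hx (hmono ⟨hj, by omega⟩ ⟨by omega, hi.2⟩ (by omega)))
      (by omega) hjt
    have h6 : s + j = s + (j - 1) + 1 := by omega
    rw [h6, pow_succ]
    linarith

end RealCoefficients

/-! ### Reduction to real coefficients and the description of U_j -/

variable {s t : ℕ} {p q : ℂ} {a : ℕ → ℂ}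

/-- A trinomial with real invariant becomes real after a rotation of the variable. -/
theorem exists_rotation_of_invariant_im_eq_zero (hst : Nat.Coprime s t) (hp : p ≠ 0) (hq : q ≠ 0)
    (h : (p ^ (s + t) / q ^ s).im = 0) :
    ∃ (w : ℂ) (p' q' : ℝ), ‖w‖ = 1 ∧ p = p' * w ^ s ∧ q = q' * w ^ (s + t) := by
  have hb : (s : ℤ) * s.gcdA (s + t) + (s + t : ℕ) * s.gcdB (s + t) = 1 := by
    rw [← Nat.gcd_eq_gcd_ab]
    simpa using hst
  set m := s.gcdA (s + t)
  set k := s.gcdB (s + t)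
  obtain ⟨δ, hδ⟩ : ∃ δ : ℝ, p ^ (s + t) / q ^ s = δ := ⟨_, (Complex.ext rfl (by simpa using h))⟩
  have hδ0 : (δ : ℂ) ≠ 0 := by
    rw [← hδ]
    exact div_ne_zero (pow_ne_zero _ hp) (pow_ne_zero _ hq)
  have hpow : p ^ (s + t) = δ * q ^ s := by
    rw [← hδ]
    field_simp
  -- With s m + (s + t) k = 1, this Bézout monomial satisfies p = δ^k v^s and q = δ^(-m) v^(s+t).
  -- Its phase is the required rotation.
  obtain ⟨v, hv⟩ : ∃ v, v = p ^ m * q ^ k := ⟨_, rfl⟩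
  have hv0 : v ≠ 0 := hv ▸ mul_ne_zero (zpow_ne_zero _ hp) (zpow_ne_zero _ hq)
  have hvn : (‖v‖ : ℂ) ≠ 0 := by exact_mod_cast norm_ne_zero_iff.2 hv0
  have e1 : p = (δ : ℂ) ^ k * v ^ s := by
    have e : v ^ s = p ^ (s * m) * (q ^ s) ^ k := by
      rw [hv, mul_pow, ← zpow_natCast, ← zpow_natCast, ← zpow_natCast, ← zpow_mul, ← zpow_mul,
        ← zpow_mul, mul_comm m, mul_comm k]
    calc p = p ^ ((s : ℤ) * m + (s + t : ℕ) * k) := by rw [hb, zpow_one]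
      _ = p ^ (s * m) * (p ^ (s + t)) ^ k := by
        rw [zpow_add₀ hp, zpow_mul p ((s + t : ℕ) : ℤ), zpow_natCast]
      _ = _ := by rw [hpow, mul_zpow, e]; ring
  have e2 : q = (δ : ℂ) ^ (-m) * v ^ (s + t) := by
    have e : v ^ (s + t) = (p ^ (s + t)) ^ m * q ^ ((s + t : ℕ) * k) := by
      rw [hv, mul_pow, ← zpow_natCast, ← zpow_natCast, ← zpow_natCast, ← zpow_mul, ← zpow_mul,
        ← zpow_mul, mul_comm m, mul_comm k]
    calc q = q ^ ((s : ℤ) * m + (s + t : ℕ) * k) := by rw [hb, zpow_one]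
      _ = (q ^ s) ^ m * q ^ ((s + t : ℕ) * k) := by
        rw [zpow_add₀ hq, zpow_mul q (s : ℤ), zpow_natCast]
      _ = _ := by
        rw [e, hpow, mul_zpow, zpow_neg]
        have := zpow_ne_zero m hδ0
        field_simp
  refine ⟨v / ‖v‖, δ ^ k * ‖v‖ ^ s, δ ^ (-m) * ‖v‖ ^ (s + t), ?_, ?_, ?_⟩
  · rw [norm_div, Complex.norm_real, norm_norm, div_self (norm_ne_zero_iff.2 hv0)]
  · rw [div_pow]
    push_cast
    rw [mul_assoc, mul_div_cancel₀ _ (pow_ne_zero _ hvn)]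
    exact e1
  · rw [div_pow]
    push_cast
    rw [mul_assoc, mul_div_cancel₀ _ (pow_ne_zero _ hvn)]
    exact e2

theorem IsRootEnumeration.div {w : ℂ} (hw : w ≠ 0)
    (ha : IsRootEnumeration s t (p * w ^ s) (q * w ^ (s + t)) a) :
    IsRootEnumeration s t p q fun i => a i / w := by
  refine Polynomial.funext fun y => ?_
  have h := eval_trinomial s t (p * w ^ s) (q * w ^ (s + t)) (w * y)
  rw [ha, eval_prod] at h
  simp only [eval_sub, eval_X, eval_C] at h
  rw [eval_trinomial, eval_prod]
  simp only [eval_sub, eval_X, eval_C]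
  have h2 : ∏ i ∈ Finset.Icc 1 (s + t), (w * y - a i) =
      w ^ (s + t) * ∏ i ∈ Finset.Icc 1 (s + t), (y - a i / w) := by
    have : w ^ (s + t) = ∏ i ∈ Finset.Icc 1 (s + t), w := by simp
    rw [this, ← Finset.prod_mul_distrib]
    exact Finset.prod_congr rfl fun i _ => by field_simp
  refine mul_left_cancel₀ (pow_ne_zero (s + t) hw) ?_
  rw [← h2, h]
  ring

theorem real_div_sign {x y c : ℝ} (hy : y ≠ 0) (k : ℕ) :
    (0 < c * (x * y ^ k) ↔ 0 < c * (x / y ^ k)) ∧ (c * (x * y ^ k) < 0 ↔ c * (x / y ^ k) < 0) := by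
  have h1 : 0 < (y ^ k) ^ 2 := by positivity
  have h2 : c * (x * y ^ k) = (c * (x / y ^ k)) * (y ^ k) ^ 2 := by field_simp
  rw [h2, mul_pos_iff_of_pos_right h1, mul_neg_iff]
  exact ⟨.rfl, by simp [h1, h1.not_gt]⟩

/-- The norm gap, read off from the invariant `p ^ (s + t) / q ^ s`. -/
theorem IsRootEnumeration.norm_ne_iff (ha : IsRootEnumeration s t p q a) (hs : 0 < s)
    (ht : 0 < t) (hst : Nat.Coprime s t) (hp : p ≠ 0) (hq : q ≠ 0)
    (hmono : MonotoneOn (fun i => ‖a i‖) (Set.Icc 1 (s + t))) {j : ℕ} (hj : 1 ≤ j)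
    (hj' : j + 1 ≤ s + t) (hjt : j ≠ t) :
    ‖a j‖ ≠ ‖a (j + 1)‖ ↔
      (-1) ^ (s + j + 1) * (p ^ (s + t) / q ^ s) ∈ Complex.slitPlane := by
  have hmj : j ∈ Finset.Icc 1 (s + t) := Finset.mem_Icc.2 ⟨hj, by omega⟩
  have hmj' : j + 1 ∈ Finset.Icc 1 (s + t) := Finset.mem_Icc.2 ⟨by omega, hj'⟩
  by_cases him : (p ^ (s + t) / q ^ s).im = 0
  · obtain ⟨w, p, q, hw, rfl, rfl⟩ := exists_rotation_of_invariant_im_eq_zero hst hp hq him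
    have hw0 : w ≠ 0 := norm_ne_zero_iff.1 (by simp [hw])
    have hp0 : p ≠ 0 := by rintro rfl; simp at hp
    have hq0 : q ≠ 0 := by rintro rfl; simp at hq
    have hinv : (-1) ^ (s + j + 1) * ((p * w ^ s) ^ (s + t) / (q * w ^ (s + t)) ^ s) =
        ((-((-1) ^ (s + j) * (p ^ (s + t) / q ^ s)) : ℝ) : ℂ) := by
      have e : (w ^ s) ^ (s + t) = (w ^ (s + t)) ^ s := by rw [← pow_mul, ← pow_mul, mul_comm]
      rw [mul_pow, mul_pow, e, mul_div_mul_right _ _ (pow_ne_zero _ (pow_ne_zero _ hw0)), pow_succ]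
      push_cast
      ring
    have ha' := ha.div hw0
    have hnorm : ∀ i, ‖a i / w‖ = ‖a i‖ := fun i => by rw [norm_div, hw, div_one]
    have hmono' : MonotoneOn (fun i => ‖a i / w‖) (Set.Icc 1 (s + t)) := by
      simpa only [hnorm] using hmono
    rw [hinv, Complex.ofReal_mem_slitPlane, neg_pos, ← (real_div_sign hq0 s).2]
    constructor
    · intro hne
      refine ha'.sign_of_norm_lt hst hp0 hq0 hmono' hj hj' hjt ?_
      simp only [hnorm]
      exact lt_of_le_of_ne (hmono ⟨hj, by omega⟩ ⟨by omega, hj'⟩ (by omega)) hne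
    · intro hneg he
      have := ha'.sign_of_norm_eq hs ht hst hp0 hq0 hmono' hj hj' (by simpa only [hnorm] using he)
      linarith
  · refine iff_of_true (fun he => him ?_) ?_
    · exact ha.invariant_im_eq_zero hs ht hst hp hq hmj hmj' (by omega) he
    · rw [Complex.mem_slitPlane_iff]
      right
      rcases neg_one_pow_eq_or ℂ (s + j + 1) with e | e <;> simpa [e] using him

theorem exists_isRootEnumeration_monotoneOn (hs : 0 < s) (p q : ℂ) :
    ∃ a, IsRootEnumeration s t p q a ∧ MonotoneOn (fun i => ‖a i‖) (Set.Icc 1 (s + t)) := by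
  have hdeg : (C p * X ^ t + C q : ℂ[X]).degree < (s + t : ℕ) := by
    refine (degree_add_le _ _).trans_lt (max_lt ?_ ?_)
    · exact (degree_C_mul_X_pow_le t p).trans_lt (by exact_mod_cast (by omega : t < s + t))
    · exact degree_C_le.trans_lt (by exact_mod_cast (by omega : 0 < s + t))
  have hmonic : (trinomial s t p q).Monic := by
    rw [trinomial, add_assoc]
    exact monic_X_pow_add hdeg
  have hnat : (trinomial s t p q).natDegree = s + t := by
    rw [trinomial, add_assoc]
    exact natDegree_eq_of_degree_eq_some (by
      rw [degree_add_eq_left_of_degree_lt (by rwa [degree_X_pow]), degree_X_pow])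
  have hsplit := IsAlgClosed.splits (trinomial s t p q)
  have hprod := hsplit.eq_prod_roots_of_monic hmonic
  have hcard : (trinomial s t p q).roots.toList.length = s + t := by
    rw [Multiset.length_toList, ← hnat]
    exact hsplit.natDegree_eq_card_roots.symm
  let f : Fin (s + t) → ℂ := fun i => (trinomial s t p q).roots.toList.get (i.cast hcard.symm)
  have hf : trinomial s t p q = ∏ i, (X - C (f i)) := by
    conv_lhs => rw [hprod, ← Multiset.coe_toList (trinomial s t p q).roots]
    rw [Multiset.map_coe, Multiset.prod_coe, ← Fin.prod_univ_fun_getElem]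
    exact (Equiv.prod_comp (finCongr hcard.symm) fun i =>
      X - C ((trinomial s t p q).roots.toList.get i)).symm
  let τ := Tuple.sort fun i => ‖f i‖
  have hτ : Monotone fun i => ‖f (τ i)‖ := Tuple.monotone_sort fun i => ‖f i‖
  -- The shift passes from indices 0, …, s+t-1 to 1, …, s+t; values outside this range are
  -- irrelevant.
  refine ⟨fun i => if h : i - 1 < s + t then f (τ ⟨i - 1, h⟩) else 0, ?_, ?_⟩
  · rw [IsRootEnumeration, hf, ← Equiv.prod_comp τ]
    refine Finset.prod_bij (fun i _ => i.1 + 1) (fun i _ => Finset.mem_Icc.2 ⟨by omega, i.2⟩)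
      (fun i _ k _ h => Fin.ext (by omega)) (fun k hk => ?_) (fun i _ => by simp)
    rw [Finset.mem_Icc] at hk
    exact ⟨⟨k - 1, by omega⟩, Finset.mem_univ _, by simp; omega⟩
  · rintro i ⟨hi, hi'⟩ k ⟨hk, hk'⟩ hik
    have h1 : i - 1 < s + t := by omega
    have h2 : k - 1 < s + t := by omega
    simp only [h1, h2, dite_true]
    exact hτ (Fin.mk_le_mk.2 (by omega))

theorem rootNormGap_eq_slitRegion (hs : 0 < s) (ht : 0 < t) (hst : Nat.Coprime s t) {j : ℕ}
    (hj : 1 ≤ j) (hj' : j + 1 ≤ s + t) (hjt : j ≠ t) :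
    rootNormGap s t j = slitRegion ((-1) ^ (s + j + 1)) (s + t) s := by
  ext x
  refine and_congr_right fun hx => ⟨?_, fun h => ?_⟩
  · rintro ⟨a, ha, hmono, hne⟩
    exact (IsRootEnumeration.norm_ne_iff ha hs ht hst hx.1 hx.2 hmono hj hj' hjt).1 hne
  · obtain ⟨a, ha, hmono⟩ := exists_isRootEnumeration_monotoneOn (t := t) hs x.1 x.2
    exact ⟨a, ha, hmono, (ha.norm_ne_iff hs ht hst hx.1 hx.2 hmono hj hj' hjt).2 h⟩

end Trinomials

/-! ### The main theorem -/

theorem mainTheorem1 (s t : ℕ) (hs : 0 < s) (ht : 0 < t) (hst : Nat.Coprime s t)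
    (j : ℕ) (hj : 1 ≤ j) (hj' : j + 1 ≤ s + t) (hjt : j ≠ t) :
    ∀ X : Set (ℂ × ℂ),
      (X = Trinomials.rootNormGap s t j ∨
        X = Trinomials.parameterSpace \ Trinomials.rootNormGap s t j) →
      (∃ γ : C(Circle, Circle × Circle), Trinomials.IsTorusKnot (s + t) s γ ∧
        Trinomials.IsDeformationRetract X (Trinomials.trace γ)) ∧
      IsConnected X ∧ ¬ IsSimplyConnected X ∧
      ∀ x : X, Nonempty (FundamentalGroup X x ≃* Multiplicative ℤ) := by
  intro X hX
  have hc : ‖((-1) ^ (s + j + 1) : ℂ)‖ = 1 := by simp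
  have hcop : Nat.Coprime (s + t) s := by simpa using hst.symm
  obtain ⟨γ, hγ, hret⟩ : ∃ γ : C(Circle, Circle × Circle), Trinomials.IsTorusKnot (s + t) s γ ∧
      Trinomials.IsDeformationRetract X (Trinomials.trace γ) := by
    rw [Trinomials.rootNormGap_eq_slitRegion hs ht hst hj hj' hjt] at hX
    rcases hX with rfl | rfl
    · exact Trinomials.exists_isDeformationRetract_slitRegion hc (by omega) hcop
    · have : Trinomials.parameterSpace \ Trinomials.slitRegion ((-1) ^ (s + j + 1)) (s + t) s =
          Trinomials.slitRay ((-1) ^ (s + j + 1)) (s + t) s := by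
        ext x
        simp only [Trinomials.slitRegion, Trinomials.slitRay, Set.mem_sdiff, Set.mem_ofPred_eq]
        tauto
      rw [this]
      exact Trinomials.exists_isDeformationRetract_slitRay hc (by omega) hcop
  exact ⟨⟨γ, hγ, hret⟩, Trinomials.topology_of_isDeformationRetract_trace hγ.1 hret⟩
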